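/- **Theorem 1.** Let $|\cdot|$ be any norm on $\mathbb{R}^n$, and denote by $|\cdot|$ also the induced operator norm on $n\times n$ matrices. Consider $$z'(t)=M(t)z(t)+M_0(t)z(\gamma(t))+h(t,z(t),z(\gamma(t))),\qquad (1)$$ under the following assumptions. (A) There are real sequences $(t_i)_{i\in\mathbb{Z}}$, $(\zeta_i)_{i\in\mathbb{Z}}$ and a constant $\theta>0$ with $t_i<t_{i+1}$, $t_i\le\zeta_i\le t_{i+1}$, $t_{i+1}-t_i\le\theta$ for all $i$, $t_i\to\pm\infty$ as $i\to\pm\infty$, and $\gamma(t)=\zeta_i$ for $t\in I_i:=[t_i,t_{i+1})$. (B) $M$, $M_0$ and, for all $x,y\in\mathbb{R}^n$, $t\mapsto h(t,x,y)$ are locally integrable on $\mathbb{R}$; there are constants $r,\mu,\ell>0$ such that for all $t\in\mathbb{R}$ and $x,y,\hat x,\hat y\in\mathbb{R}^n$ $$|h(t,x,y)|\le r(|x|+|y|)+\mu,\qquad |h(t,x,y)-h(t,\hat x,\hat y)|\le \ell(|x-\hat x|+|y-\hat y|).$$ (C) With $\rho_i^+(Q)=\exp\int_{t_i}^{\zeta_i}|Q(s)|\,ds$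 and $\rho_i^-(Q)=\exp\int_{\zeta_i}^{t_{i+1}}|Q(s)|\,ds$ there are $\nu^\pm\in(0,1)$ such that $\sup_i\rho_i^+(M)\ln\rho_i^+(M_0)\le\nu^+$, $\sup_i\rho_i^-(M)\ln\rho_i^-(M_0)\le\nu^-$, and $\rho(M):=\sup_i\rho_i^+(M)\rho_i^-(M)<\infty$. Let $\Phi$ be the fundamental matrix of $x'=M(t)x$ with $\Phi(0)=I$ (continuous, with $\Phi(t)=I+\int_0^tM(s)\Phi(s)\,ds$), $\Phi(t,s)=\Phi(t)\Phi(s)^{-1}$ and $E(t,\tau)=\Phi(t,\tau)+\int_\tau^t\Phi(t,s)M_0(s)\,ds$. For $t,s\in[t_i,t_{i+1}]$ put $Z_i(t,s)=E(t,\zeta_i)E(s,\zeta_i)^{-1}$. The transition matrix $Z(t,\tau)$ of the linear equation $z'(t)=M(t)z(t)+M_0(t)z(\gamma(t))$ is, for $t\in I_j$, $\tau\in I_i$, $$Z(t,\tau)=\begin{cases}Z_i(t,\tau), & i=j,\\ Z_j(t,t_j)\,Z_{j-1}(t_j,t_{j-1})\cdots Z_{i+1}(t_{i+2},t_{i+1})\,Z_i(t_{i+1},\tau),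 & i<j,\\ Z_j(t,t_{j+1})\,Z_{j+1}(t_{j+1},t_{j+2})\cdots Z_{i-1}(t_{i-1},t_i)\,Z_i(t_i,\tau), & i>j.\end{cases}$$ For a projection $P$ ($P^2=P$) let $Z_P(t,s)=Z(t,0)PZ(0,s)$ if $t\ge s$ and $Z_P(t,s)=-Z(t,0)(I-P)Z(0,s)$ if $t<s$. Assume that the linear equation has an $\alpha$-exponential dichotomy on $\mathbb{R}$ with projection $P$ and constants $K\ge1$, $\alpha>0$, that is, $|Z_P(t,s)|\le Ke^{-\alpha|t-s|}$ for all $t,s\in\mathbb{R}$. The Green function is $\tilde G(t,s)=A(t,s)+B(t,s)$, where $$A(t,s)=\begin{cases}Z_P(t,t_r)\Phi(t_r,s), & s\in[t_r,\zeta_r),\\ Z_P(t,t_{r+1})\Phi(t_{r+1},s), & s\in[\zeta_r,t_{r+1}),\end{cases}\quad r\in\mathbb{Z},$$ and, for $t\in I_j$, $B(t,s)=\Phi(t,s)$ if $\zeta_j\le s<t$, $B(t,s)=-\Phi(t,s)$ if $t\le s<\zeta_j$, and $B(t,s)=0$ otherwise. Put $\tilde G_1(t,s)=\tilde G(t,s)$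 for $t\ge s$ and $\tilde G_2(t,s)=-\tilde G(t,s)$ for $t<s$. A *solution* of (1) is a continuous $z:\mathbb{R}\to\mathbb{R}^n$ for which $s\mapsto M(s)z(s)+M_0(s)z(\gamma(s))+h(s,z(s),z(\gamma(s)))$ is locally integrable and $z(b)-z(a)$ equals its integral over $[a,b]$ for all $a,b\in\mathbb{R}$. A *classical solution* is a continuous $z$ that satisfies (1) at every $t\in\bigcup_i(t_i,t_{i+1})$ and satisfies it with the right derivative at every $t_i$. Let $\rho^*(M)=\rho(M)e^{\alpha\theta}$ and suppose that $$8K\ell\rho^*(M)\alpha^{-1}\le1,\qquad 4Kr\rho^*(M)\alpha^{-1}\le1 .$$ Then (1) has exactly one solution $z$ that is bounded on $\mathbb{R}$. For every $t\in\mathbb{R}$ $$z(t)=\int_{-\infty}^t\tilde G_1(t,s)h(s,z(s),z(\gamma(s)))\,ds-\int_t^{+\infty}\tilde G_2(t,s)h(s,z(s),z(\gamma(s)))\,ds ,$$ with absolutely convergent integrals, and $$|z(t)|\le\sigma:=\frac{2K\mu\rho^*(M)}{\alpha-4rK\rho^*(M)}$$ (read as $\sigma=+\infty$, that is, no claim,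 if $4rK\rho^*(M)=\alpha$). Moreover every bounded classical solution of (1) equals $z$, and if $M$, $M_0$ and all the functions $t\mapsto h(t,x,y)$ are continuous on each $[t_i,t_{i+1})$, then $z$ is a classical solution. -/

import Mathlib

open Set Filter MeasureTheory Topology

noncomputable section

namespace Depcag

/-- Standing assumption on the grid `T`, the nodes `ζ` and the deviating argument `γ`;
`θ` bounds the lengths of the intervals `[T i, T (i+1))`. -/
structure PiecewiseArgument (T ζ : ℤ → ℝ) (γ : ℝ → ℝ) (θ : ℝ) : Prop where
  grid_lt : ∀ i, T i < T (i + 1)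
  node_mem : ∀ i, ζ i ∈ Icc (T i) (T (i + 1))
  tendsto_top : Tendsto T atTop atTop
  tendsto_bot : Tendsto T atBot atBot
  arg_eq : ∀ i, ∀ t ∈ Ico (T i) (T (i + 1)), γ t = ζ i
  theta_pos : 0 < θ
  length_le : ∀ i, T (i + 1) - T i ≤ θ

/-- The index `i` of the grid interval `[T i, T (i+1))` that contains `t`. -/
def gridIndex (T : ℤ → ℝ) (t : ℝ) : ℤ :=
  Classical.epsilon fun i : ℤ => t ∈ Ico (T i) (T (i + 1))

variable {V : Type*} [NormedAddCommGroup V] [NormedSpace ℝ V]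

/-- Local integrability of the data; linear growth and Lipschitz bounds for the nonlinearity. -/
structure GrowthLipschitz (M M₀ : ℝ → V →L[ℝ] V) (h : ℝ → V → V → V) (r μ ℓ : ℝ) : Prop where
  locInt_M : LocallyIntegrable M volume
  locInt_M₀ : LocallyIntegrable M₀ volume
  locInt_h : ∀ x y : V, LocallyIntegrable (fun t => h t x y) volume
  r_pos : 0 < r
  mu_pos : 0 < μ
  ell_pos : 0 < ℓ
  growth : ∀ t x y, ‖h t x y‖ ≤ r * (‖x‖ + ‖y‖) + μ
  lipschitz : ∀ t x y x' y', ‖h t x y - h t x' y'‖ ≤ ℓ * (‖x - x'‖ + ‖y - y'‖)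

/-- `ρ_i^+(Q) = exp ∫_{T i}^{ζ i} |Q|`. -/
def rhoPlus (T ζ : ℤ → ℝ) (Q : ℝ → V →L[ℝ] V) (i : ℤ) : ℝ :=
  Real.exp (∫ s in (T i)..(ζ i), ‖Q s‖)

/-- `ρ_i^-(Q) = exp ∫_{ζ i}^{T (i+1)} |Q|`. -/
def rhoMinus (T ζ : ℤ → ℝ) (Q : ℝ → V →L[ℝ] V) (i : ℤ) : ℝ :=
  Real.exp (∫ s in (ζ i)..(T (i + 1)), ‖Q s‖)

/-- `ρ(Q) = sup_i ρ_i^+(Q) ρ_i^-(Q)`. -/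
def rho (T ζ : ℤ → ℝ) (Q : ℝ → V →L[ℝ] V) : ℝ :=
  ⨆ i : ℤ, rhoPlus T ζ Q i * rhoMinus T ζ Q i

/-- `ρ*(Q) = ρ(Q) e^{αθ}`. -/
def rhoStar (T ζ : ℤ → ℝ) (Q : ℝ → V →L[ℝ] V) (α θ : ℝ) : ℝ :=
  rho T ζ Q * Real.exp (α * θ)

/-- Smallness of `M₀` on the two parts of every grid interval, and finiteness of `ρ(M)`. -/
structure SmallnessCondition (T ζ : ℤ → ℝ) (M M₀ : ℝ → V →L[ℝ] V) (νp νm : ℝ) : Prop where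
  nu_plus_mem : νp ∈ Ioo (0 : ℝ) 1
  nu_minus_mem : νm ∈ Ioo (0 : ℝ) 1
  plus_le : ∀ i, rhoPlus T ζ M i * Real.log (rhoPlus T ζ M₀ i) ≤ νp
  minus_le : ∀ i, rhoMinus T ζ M i * Real.log (rhoMinus T ζ M₀ i) ≤ νm
  rho_finite : BddAbove (range fun i : ℤ => rhoPlus T ζ M i * rhoMinus T ζ M i)

/-- `Φ` is the fundamental operator of `x' = M(t) x` with `Φ(0) = I`, the equation being
understood in integrated form, as it must be when `M` is only locally integrable. -/
def IsFundamental (M Φ : ℝ → V →L[ℝ] V) : Prop :=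
  Continuous Φ ∧ ∀ t, Φ t = 1 + ∫ s in (0 : ℝ)..t, M s * Φ s

/-- The fundamental operator of `x' = M(t) x` (it exists and is unique if `M` is locally
integrable and `V` is complete). -/
def fundamental (M : ℝ → V →L[ℝ] V) : ℝ → V →L[ℝ] V :=
  Classical.epsilon (IsFundamental M)

/-- `Φ(t,s) = Φ(t) Φ(s)⁻¹`. -/
def evolution (M : ℝ → V →L[ℝ] V) (t s : ℝ) : V →L[ℝ] V :=
  fundamental M t * Ring.inverse (fundamental M s)

/-- `E(t,τ) = Φ(t,τ) + ∫_τ^t Φ(t,s) M₀(s) ds`. -/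
def nodeEvolution (M M₀ : ℝ → V →L[ℝ] V) (t τ : ℝ) : V →L[ℝ] V :=
  evolution M t τ + ∫ s in τ..t, evolution M t s * M₀ s

/-- `E(t,ζ i) E(s,ζ i)⁻¹`: the transition from `s` to `t` inside `[T i, T (i+1)]`. -/
def localTransition (ζ : ℤ → ℝ) (M M₀ : ℝ → V →L[ℝ] V) (i : ℤ) (t s : ℝ) : V →L[ℝ] V :=
  nodeEvolution M M₀ t (ζ i) * Ring.inverse (nodeEvolution M M₀ s (ζ i))

/-- The backward-ordered product of `n` grid steps, leading from `T i` to `T (i+n)`. -/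
def productUp (T ζ : ℤ → ℝ) (M M₀ : ℝ → V →L[ℝ] V) (i : ℤ) : ℕ → V →L[ℝ] V
  | 0 => 1
  | n + 1 => localTransition ζ M M₀ (i + n) (T (i + n + 1)) (T (i + n)) *
      productUp T ζ M M₀ i n

/-- The forward-ordered product of `n` inverse grid steps, leading from `T (i+n)` to `T i`. -/
def productDown (T ζ : ℤ → ℝ) (M M₀ : ℝ → V →L[ℝ] V) (i : ℤ) : ℕ → V →L[ℝ] V
  | 0 => 1
  | n + 1 => productDown T ζ M M₀ i n *
      localTransition ζ M M₀ (i + n) (T (i + n)) (T (i + n + 1))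

/-- The transition operator `Z(t,τ)` of `z'(t) = M(t) z(t) + M₀(t) z(γ(t))`. -/
def transition (T ζ : ℤ → ℝ) (M M₀ : ℝ → V →L[ℝ] V) (t τ : ℝ) : V →L[ℝ] V :=
  let j := gridIndex T t
  let i := gridIndex T τ
  if i = j then localTransition ζ M M₀ i t τ
  else if i < j then
    localTransition ζ M M₀ j t (T j) * productUp T ζ M M₀ (i + 1) (j - i - 1).toNat *
      localTransition ζ M M₀ i (T (i + 1)) τ
  else
    localTransition ζ M M₀ j t (T (j + 1)) * productDown T ζ M M₀ (j + 1) (i - j - 1).toNat *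
      localTransition ζ M M₀ i (T i) τ

/-- `Z_P(t,s)`. -/
def transitionP (T ζ : ℤ → ℝ) (M M₀ : ℝ → V →L[ℝ] V) (P : V →L[ℝ] V) (t s : ℝ) : V →L[ℝ] V :=
  if s ≤ t then transition T ζ M M₀ t 0 * P * transition T ζ M M₀ 0 s
  else -(transition T ζ M M₀ t 0 * (1 - P) * transition T ζ M M₀ 0 s)

/-- The linear equation has an `α`-exponential dichotomy on `ℝ` with projection `P` and
constants `K`, `α`. -/
structure ExpDichotomy (T ζ : ℤ → ℝ) (M M₀ : ℝ → V →L[ℝ] V) (P : V →L[ℝ] V) (K α : ℝ) :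
    Prop where
  proj : P * P = P
  one_le_K : 1 ≤ K
  alpha_pos : 0 < α
  bound : ∀ t s, ‖transitionP T ζ M M₀ P t s‖ ≤ K * Real.exp (-α * |t - s|)

/-- The Green operator `G(t,s)`. For `s` in `[T r, T (r+1))` it is `Z_P(t, T r) Φ(T r, s)` or
`Z_P(t, T (r+1)) Φ(T (r+1), s)` according as `s < ζ r` or `s ≥ ζ r`; if moreover `s` lies between
`t` and the node `ζ j` of the interval of `t`, then `± Φ(t,s)` is added. -/
def green (T ζ : ℤ → ℝ) (M M₀ : ℝ → V →L[ℝ] V) (P : V →L[ℝ] V) (t s : ℝ) : V →L[ℝ] V :=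
  let j := gridIndex T t
  let r := gridIndex T s
  (if s < ζ r then transitionP T ζ M M₀ P t (T r) * evolution M (T r) s
    else transitionP T ζ M M₀ P t (T (r + 1)) * evolution M (T (r + 1)) s) +
  (if ζ j ≤ s ∧ s < t then evolution M t s
    else if t ≤ s ∧ s < ζ j then -evolution M t s
    else 0)

/-- `G₁(t,s) = G(t,s)` for `t ≥ s`. -/
def green₁ (T ζ : ℤ → ℝ) (M M₀ : ℝ → V →L[ℝ] V) (P : V →L[ℝ] V) (t s : ℝ) : V →L[ℝ] V :=
  if s ≤ t then green T ζ M M₀ P t s else 0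

/-- `G₂(t,s) = -G(t,s)` for `t < s`. -/
def green₂ (T ζ : ℤ → ℝ) (M M₀ : ℝ → V →L[ℝ] V) (P : V →L[ℝ] V) (t s : ℝ) : V →L[ℝ] V :=
  if t < s then -green T ζ M M₀ P t s else 0

/-- The right-hand side `M(t) z(t) + M₀(t) z(γ(t)) + h(t, z(t), z(γ(t)))`. -/
def field (γ : ℝ → ℝ) (M M₀ : ℝ → V →L[ℝ] V) (h : ℝ → V → V → V) (z : ℝ → V) (t : ℝ) : V :=
  M t (z t) + M₀ t (z (γ t)) + h t (z t) (z (γ t))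

/-- `z` is a solution on `ℝ` in the sense of Carathéodory: it is continuous and it is an
indefinite integral of the right-hand side. -/
def IsSolution (γ : ℝ → ℝ) (M M₀ : ℝ → V →L[ℝ] V) (h : ℝ → V → V → V) (z : ℝ → V) : Prop :=
  Continuous z ∧ ∀ a b : ℝ, IntervalIntegrable (field γ M M₀ h z) volume a b ∧
    z b - z a = ∫ s in a..b, field γ M M₀ h z s

/-- `z` is a classical solution on `ℝ`: it is continuous, satisfies the equation at every point
off the grid, and satisfies it with the right derivative at the grid points. -/
def IsClassicalSolution (T : ℤ → ℝ) (γ : ℝ → ℝ) (M M₀ : ℝ → V →L[ℝ] V) (h : ℝ → V → V → V)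
    (z : ℝ → V) : Prop :=
  Continuous z ∧
    (∀ i, ∀ t ∈ Ioo (T i) (T (i + 1)), HasDerivAt z (field γ M M₀ h z t) t) ∧
    ∀ i, HasDerivWithinAt z (field γ M M₀ h z (T i)) (Ici (T i)) (T i)

/-- `z` is bounded on `ℝ`. -/
def IsBoundedOnLine (z : ℝ → V) : Prop := ∃ C : ℝ, ∀ t, ‖z t‖ ≤ C

/-- The data are continuous on every grid interval `[T i, T (i+1))`. -/
def PiecewiseContinuousData (T : ℤ → ℝ) (M M₀ : ℝ → V →L[ℝ] V) (h : ℝ → V → V → V) : Prop :=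
  ∀ i, ContinuousOn M (Ico (T i) (T (i + 1))) ∧ ContinuousOn M₀ (Ico (T i) (T (i + 1))) ∧
    ∀ x y : V, ContinuousOn (fun t => h t x y) (Ico (T i) (T (i + 1)))

end Depcag

end

/-! On `[T j, T (j+1))` the deviating argument is frozen at `ζ j`. A solution of the linear equation
with forcing `f` therefore satisfies the ordinary equation `u' = M u + M₀ u(ζ j) + f` there, and
variation of constants gives `u(t) = E(t,ζ j) u(ζ j) + ∫_{ζ j}^t Φ(t,s) f(s) ds`. Smallness of `M₀`
makes `E(t,ζ j)` invertible (`isUnit_nodeEvolution`), so the pieces glue to invertible operators `W`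
with `Z(t,s) = W(t) W(s)⁻¹` (`exists_transition_units`).

The Green operator has a main part `Z_P(t,T k) Φ(T k,s)`, where `T k` lies between the same
consecutive nodes as `s`, and a local part supported between `t` and the node of its interval.
Inside a grid interval the main part is propagated by `Z`. At `T (j+1)` it gains `Φ(T (j+1),s)` for
`ζ j ≤ s < ζ (j+1)`, and this compensates the change of base node from `ζ j` to `ζ (j+1)` in the
local part. Hence `u(t) = ∫ G(t,s) f(s) ds` solves the forced equation (`isSolution_green`). The
dichotomy excludes nonzero bounded homogeneous solutions (`eq_zero_of_bounded`), so the bounded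
solutions of the nonlinear equation are exactly the bounded continuous fixed points of `z ↦ ∫ G(t,s)
h(s,z(s),z(γ s)) ds`.

The quantitative core is `|∫ G(t,s) f(s) ds| ≤ 2Kρ*α⁻¹ C` for `|f| ≤ C` (`integrable_green_apply`).
With it the Lipschitz bound makes the fixed-point map a `1/2`-contraction, and the growth bound
gives `σ`. The coefficients are only locally integrable, so the calculus needed is that of
absolutely continuous functions; finite dimension enters only through completeness. -/

noncomputable section

namespace Depcag

/-! ### Calculus of indefinite integrals and Gronwall's inequality -/

section Calculus

variable {E F G : Type*} [NormedAddCommGroup E] [NormedSpace ℝ E]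
  [NormedAddCommGroup F] [NormedSpace ℝ F] [NormedAddCommGroup G] [NormedSpace ℝ G]

omit [NormedSpace ℝ E] in
theorem _root_.MeasureTheory.LocallyIntegrable.intervalIntegrable' {f : ℝ → E}
    (hf : LocallyIntegrable f volume) (a b : ℝ) : IntervalIntegrable f volume a b :=
  intervalIntegrable_iff.mpr <|
    (hf.integrableOn_isCompact isCompact_uIcc).mono_set uIoc_subset_uIcc

omit [NormedSpace ℝ E] in
theorem locallyIntegrable_of_intervalIntegrable {f : ℝ → E}
    (hf : ∀ a b : ℝ, IntervalIntegrable f volume a b) : LocallyIntegrable f volume := by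
  intro x
  refine ⟨Ioc (x - 1) (x + 1), ?_, ?_⟩
  · exact Ioc_mem_nhds (by linarith) (by linarith)
  · exact (intervalIntegrable_iff_integrableOn_Ioc_of_le (by linarith)).1 (hf _ _)

theorem _root_.MeasureTheory.LocallyIntegrable.continuous_primitive' {f : ℝ → E}
    (hf : LocallyIntegrable f volume) (a : ℝ) : Continuous fun t => ∫ s in a..t, f s :=
  intervalIntegral.continuous_primitive (fun a b => hf.intervalIntegrable' a b) a

/-- Continuity of `g` is not demanded because this is applied to `M₀ s (z (γ s))`, where `z ∘ γ` is
a step function. -/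
theorem _root_.MeasureTheory.LocallyIntegrable.bilin {f : ℝ → E} {g : ℝ → F}
    (B : E →L[ℝ] F →L[ℝ] G) (hf : LocallyIntegrable f volume)
    (hg : AEStronglyMeasurable g volume)
    (hb : ∀ K, IsCompact K → ∃ C, ∀ x ∈ K, ‖g x‖ ≤ C) :
    LocallyIntegrable (fun s => B (f s) (g s)) volume := by
  rw [locallyIntegrable_iff]
  intro K hK
  obtain ⟨C, hC⟩ := hb K hK
  have hfK := hf.integrableOn_isCompact hK
  refine Integrable.mono' (hfK.norm.const_mul (‖B‖ * C))
    (B.aestronglyMeasurable_comp₂ hfK.aestronglyMeasurable hg.restrict) ?_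
  filter_upwards [ae_restrict_mem hK.measurableSet] with x hx
  calc ‖B (f x) (g x)‖ ≤ ‖B‖ * ‖f x‖ * ‖g x‖ := B.le_opNorm₂ _ _
    _ ≤ ‖B‖ * ‖f x‖ * C := by gcongr; exact hC x hx
    _ = _ := by ring

theorem _root_.MeasureTheory.LocallyIntegrable.bilin_continuous {f : ℝ → E} {g : ℝ → F}
    (B : E →L[ℝ] F →L[ℝ] G) (hf : LocallyIntegrable f volume) (hg : Continuous g) :
    LocallyIntegrable (fun s => B (f s) (g s)) volume :=
  hf.bilin B hg.aestronglyMeasurable fun _ hK => hK.exists_bound_of_continuousOn hg.continuousOn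

theorem _root_.MeasureTheory.LocallyIntegrable.clm_apply {f : ℝ → E →L[ℝ] F} {g : ℝ → E}
    (hf : LocallyIntegrable f volume) (hg : Continuous g) :
    LocallyIntegrable (fun s => f s (g s)) volume :=
  hf.bilin_continuous (ContinuousLinearMap.id ℝ (E →L[ℝ] F)) hg

theorem _root_.MeasureTheory.LocallyIntegrable.continuous_clm_apply {f : ℝ → E →L[ℝ] F}
    {g : ℝ → E} (hg : LocallyIntegrable g volume) (hf : Continuous f) :
    LocallyIntegrable (fun s => f s (g s)) volume :=
  hg.bilin_continuous (ContinuousLinearMap.id ℝ (E →L[ℝ] F)).flip hf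

/-- The fundamental theorem of calculus for a function whose increments are controlled by an
indefinite integral. -/
theorem integral_eq_sub_of_ae_hasDerivAt [CompleteSpace E] {f f' : ℝ → E} {g : ℝ → ℝ} {a b C : ℝ}
    (hg : LocallyIntegrable g volume)
    (hfg : ∀ x ∈ uIcc a b, ∀ y ∈ uIcc a b, ‖f y - f x‖ ≤ C * |∫ s in x..y, g s|)
    (hf' : LocallyIntegrable f' volume) (hd : ∀ᵐ x, HasDerivAt f (f' x) x) :
    ∫ s in a..b, f' s = f b - f a := by
  set u : ℝ → E := fun t => f t - ∫ s in a..t, f' s with hu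
  have hi := fun (k : ℝ → ℝ) (hk : LocallyIntegrable k volume) =>
    (hk.intervalIntegrable' a b).absolutelyContinuousOnInterval_intervalIntegral
      (c := a) left_mem_uIcc
  -- The increments of `u` are dominated by those of `|C| ∫ g` and `∫ ‖f'‖`, both absolutely
  -- continuous. As `u' = 0` almost everywhere, `u` is then constant.
  have hAC : AbsolutelyContinuousOnInterval u a b := by
    have h1 := (hi g hg).const_smul C
    have hf'n : LocallyIntegrable (fun s => ‖f' s‖) volume := fun x => (hf' x).norm
    have h2 := hi _ hf'n
    refine squeeze_zero' (Eventually.of_forall fun E => Finset.sum_nonneg fun _ _ => dist_nonneg)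
      ?_ (by simpa using (Tendsto.add h1 h2))
    filter_upwards [mem_inf_of_right (mem_principal_self _)] with E hE
    rw [← Finset.sum_add_distrib]
    refine Finset.sum_le_sum fun i hi' => ?_
    have hx : (E.2 i).1 ∈ uIcc a b := (hE.1 i hi').1
    have hy : (E.2 i).2 ∈ uIcc a b := (hE.1 i hi').2
    have e1 : ∀ x y, (∫ s in a..x, g s) - ∫ s in a..y, g s = ∫ s in y..x, g s := fun x y =>
      intervalIntegral.integral_interval_sub_left (hg.intervalIntegrable' _ _)
        (hg.intervalIntegrable' _ _)
    have e2 : ∀ x y, (∫ s in a..x, f' s) - ∫ s in a..y, f' s = ∫ s in y..x, f' s := fun x y =>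
      intervalIntegral.integral_interval_sub_left (hf'.intervalIntegrable' _ _)
        (hf'.intervalIntegrable' _ _)
    have e3 : ∀ x y, (∫ s in a..x, ‖f' s‖) - ∫ s in a..y, ‖f' s‖ = ∫ s in y..x, ‖f' s‖ :=
      fun x y => intervalIntegral.integral_interval_sub_left (hf'n.intervalIntegrable' _ _)
        (hf'n.intervalIntegrable' _ _)
    simp only [dist_eq_norm, hu, ← mul_sub]
    rw [e1, e3, sub_sub_sub_comm, e2]
    refine (norm_sub_le _ _).trans (add_le_add ?_ ?_)
    · refine (hfg _ hy _ hx).trans ?_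
      rw [norm_mul]
      exact mul_le_mul_of_nonneg_right (le_abs_self _) (abs_nonneg _)
    · exact intervalIntegral.norm_integral_le_abs_integral_norm
  have h0 : ∀ᵐ x, x ∈ uIcc a b → HasDerivAt u 0 x := by
    filter_upwards [hd, LocallyIntegrable.ae_hasDerivAt_integral hf'] with x h1 h2 _
    have h3 := h1.sub (h2 a)
    rwa [sub_self] at h3
  obtain ⟨c, hc⟩ := hAC.const_of_ae_hasDerivAt_zero h0
  have ha := hc a left_mem_uIcc
  have hb := hc b right_mem_uIcc
  simp only [hu, intervalIntegral.integral_same, sub_zero] at ha hb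
  rw [ha, ← hb]; abel

/-- The product rule for indefinite integrals. -/
theorem integral_bilin [CompleteSpace E] [CompleteSpace F] [CompleteSpace G]
    (B : E →L[ℝ] F →L[ℝ] G) {f f' : ℝ → E} {g g' : ℝ → F} {a : ℝ}
    (hf' : LocallyIntegrable f' volume) (hg' : LocallyIntegrable g' volume)
    (hf : ∀ t, f t = f a + ∫ s in a..t, f' s) (hg : ∀ t, g t = g a + ∫ s in a..t, g' s) (t : ℝ) :
    B (f t) (g t) = B (f a) (g a) + ∫ s in a..t, (B (f' s) (g s) + B (f s) (g' s)) := by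
  have hfc : Continuous f := by
    rw [show f = _ from funext hf]; exact continuous_const.add (hf'.continuous_primitive' a)
  have hgc : Continuous g := by
    rw [show g = _ from funext hg]; exact continuous_const.add (hg'.continuous_primitive' a)
  have hfd : ∀ x y, f y - f x = ∫ s in x..y, f' s := fun x y => by
    rw [hf y, hf x, add_sub_add_left_eq_sub, intervalIntegral.integral_interval_sub_left
      (hf'.intervalIntegrable' _ _) (hf'.intervalIntegrable' _ _)]
  have hgd : ∀ x y, g y - g x = ∫ s in x..y, g' s := fun x y => by
    rw [hg y, hg x, add_sub_add_left_eq_sub, intervalIntegral.integral_interval_sub_left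
      (hg'.intervalIntegrable' _ _) (hg'.intervalIntegrable' _ _)]
  obtain ⟨C₁, hC₁⟩ := isCompact_uIcc.exists_bound_of_continuousOn (s := uIcc a t) hfc.continuousOn
  obtain ⟨C₂, hC₂⟩ := isCompact_uIcc.exists_bound_of_continuousOn (s := uIcc a t) hgc.continuousOn
  have h1 : LocallyIntegrable (fun s => B (f' s) (g s)) volume := hf'.bilin_continuous B hgc
  have h2 : LocallyIntegrable (fun s => B (f s) (g' s)) volume := hg'.bilin_continuous B.flip hfc
  have hn : LocallyIntegrable (fun s => ‖f' s‖ + ‖g' s‖) volume := 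
    LocallyIntegrable.add (fun x => (hf' x).norm) fun x => (hg' x).norm
  have key := integral_eq_sub_of_ae_hasDerivAt (f := fun t => B (f t) (g t)) (a := a) (b := t)
    (C := ‖B‖ * (|C₁| + |C₂|)) hn ?_ (h1.add h2) ?_
  · rw [← add_sub_cancel (B (f a) (g a)) (B (f t) (g t)), ← key]
    simp
  · intro x hx y hy
    have n1 : ‖f y - f x‖ ≤ |∫ s in x..y, (‖f' s‖ + ‖g' s‖)| := by
      rw [hfd]
      refine intervalIntegral.norm_integral_le_abs_of_norm_le (Eventually.of_forall fun s => ?_)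
        (hn.intervalIntegrable' _ _)
      have := norm_nonneg (g' s); linarith
    have n2 : ‖g y - g x‖ ≤ |∫ s in x..y, (‖f' s‖ + ‖g' s‖)| := by
      rw [hgd]
      refine intervalIntegral.norm_integral_le_abs_of_norm_le (Eventually.of_forall fun s => ?_)
        (hn.intervalIntegrable' _ _)
      have := norm_nonneg (f' s); linarith
    have e : B (f y) (g y) - B (f x) (g x) = B (f y - f x) (g y) + B (f x) (g y - g x) := by
      simp
    rw [e]
    have b1 := hC₁ x hx
    have b2 := hC₂ y hy
    calc _ ≤ ‖B‖ * ‖f y - f x‖ * ‖g y‖ + ‖B‖ * ‖f x‖ * ‖g y - g x‖ :=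
          (norm_add_le _ _).trans (add_le_add (B.le_opNorm₂ _ _) (B.le_opNorm₂ _ _))
      _ ≤ ‖B‖ * |∫ s in x..y, (‖f' s‖ + ‖g' s‖)| * |C₂| +
          ‖B‖ * |C₁| * |∫ s in x..y, (‖f' s‖ + ‖g' s‖)| := by
            gcongr
            · exact b2.trans (le_abs_self _)
            · exact b1.trans (le_abs_self _)
      _ = _ := by ring
  · filter_upwards [LocallyIntegrable.ae_hasDerivAt_integral hf',
      LocallyIntegrable.ae_hasDerivAt_integral hg'] with x hx hx'
    have d1 : HasDerivAt f (f' x) x := by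
      rw [show f = _ from funext hf]; exact (hx a).const_add _
    have d2 : HasDerivAt g (g' x) x := by
      rw [show g = _ from funext hg]; exact (hx' a).const_add _
    have := (B.hasFDerivAt.comp_hasDerivAt x d1).clm_apply d2
    simpa using this

/-- The chain rule for the exponential of an indefinite integral. -/
theorem integral_mul_exp {g : ℝ → ℝ} (hg : LocallyIntegrable g volume) (c a b : ℝ) :
    ∫ s in a..b, g s * Real.exp (∫ τ in c..s, g τ) =
      Real.exp (∫ τ in c..b, g τ) - Real.exp (∫ τ in c..a, g τ) := by
  have hc := hg.continuous_primitive' c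
  obtain ⟨R, hR⟩ := isCompact_uIcc.exists_bound_of_continuousOn (s := uIcc a b) hc.continuousOn
  -- `R` bounds the primitive on the interval, and `exp` is Lipschitz with constant `exp R` on `(-∞,
  -- R]`.
  refine integral_eq_sub_of_ae_hasDerivAt (f := fun t => Real.exp (∫ τ in c..t, g τ))
    (C := Real.exp R) hg ?_ ?_ ?_
  · intro x hx y hy
    have := Convex.norm_image_sub_le_of_norm_deriv_le (f := Real.exp) (s := Iic R)
      (C := Real.exp R) (x := ∫ τ in c..x, g τ) (y := ∫ τ in c..y, g τ)
      (fun _ _ => Real.differentiableAt_exp)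
      (fun z hz => by simpa using hz) (convex_Iic R)
      ((le_abs_self _).trans (hR x hx)) ((le_abs_self _).trans (hR y hy))
    rwa [intervalIntegral.integral_interval_sub_left (hg.intervalIntegrable' _ _)
      (hg.intervalIntegrable' _ _)] at this
  · exact hg.bilin_continuous (ContinuousLinearMap.mul ℝ ℝ) (Real.continuous_exp.comp hc)
  · filter_upwards [LocallyIntegrable.ae_hasDerivAt_integral hg] with x hx
    simpa [mul_comm] using (hx c).exp

/-- Gronwall's inequality with a locally integrable coefficient. -/
theorem gronwall_integral {g u : ℝ → ℝ} {a b c : ℝ} (hg : LocallyIntegrable g volume)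
    (hg0 : ∀ s, 0 ≤ g s) (hu : Continuous u) (hab : a ≤ b)
    (h : ∀ t ∈ Icc a b, u t ≤ c + ∫ s in a..t, g s * u s) :
    u b ≤ c * Real.exp (∫ s in a..b, g s) := by
  have hm := hg.continuous_primitive' a
  have hgu : LocallyIntegrable (fun s => g s * u s) volume :=
    hg.bilin_continuous (ContinuousLinearMap.mul ℝ ℝ) hu
  have hng : LocallyIntegrable (fun s => -g s) volume := hg.neg
  set U : ℝ → ℝ := fun t => c + ∫ s in a..t, g s * u s with hU
  set e : ℝ → ℝ := fun t => Real.exp (∫ s in a..t, -g s) with he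
  have hUc : Continuous U := continuous_const.add (hgu.continuous_primitive' a)
  have hec : Continuous e := Real.continuous_exp.comp (hng.continuous_primitive' a)
  have hne : LocallyIntegrable (fun s => -g s * e s) volume :=
    hng.bilin_continuous (ContinuousLinearMap.mul ℝ ℝ) hec
  -- Integrating factor: `(e U)' = -g e (U - u) ≤ 0`, so `e U` does not exceed its initial value
  -- `c`.
  have key := integral_bilin (ContinuousLinearMap.mul ℝ ℝ) (f := e) (g := U) (a := a) hne hgu
    (fun t => by
      have := integral_mul_exp hng a a t
      simp only [he]
      rw [this]; simp) (fun t => by simp [hU]) b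
  simp only [ContinuousLinearMap.mul_apply'] at key
  have hle : (∫ s in a..b, (-g s * e s * U s + e s * (g s * u s))) ≤ 0 := by
    rw [intervalIntegral.integral_of_le hab]
    refine integral_nonpos_of_ae ?_
    filter_upwards [ae_restrict_mem measurableSet_Ioc] with s hs
    have h1 := h s ⟨hs.1.le, hs.2⟩
    have : -g s * e s * U s + e s * (g s * u s) = - (g s * e s * (U s - u s)) := by ring
    rw [this]
    exact neg_nonpos.2 (mul_nonneg (mul_nonneg (hg0 s) (Real.exp_pos _).le) (sub_nonneg.2 h1))
  have h3 : e b * U b ≤ c := by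
    have e0 : e a * U a = c := by simp [he, hU]
    linarith
  have h4 : e b * Real.exp (∫ s in a..b, g s) = 1 := by
    simp only [he]
    rw [← Real.exp_add]; simp
  calc u b ≤ U b := h b ⟨hab, le_rfl⟩
    _ = e b * U b * Real.exp (∫ s in a..b, g s) := by
      rw [mul_right_comm, h4, one_mul]
    _ ≤ _ := by gcongr

omit [NormedSpace ℝ E] in
/-- Two-sided form of Gronwall's inequality for norms. -/
theorem norm_le_of_le_abs_integral {g : ℝ → ℝ} {x : ℝ → E} {a b c : ℝ}
    (hg : LocallyIntegrable g volume) (hg0 : ∀ s, 0 ≤ g s) (hx : Continuous x)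
    (h : ∀ t ∈ uIcc a b, ‖x t‖ ≤ c + |∫ s in a..t, g s * ‖x s‖|) :
    ‖x b‖ ≤ c * Real.exp |∫ s in a..b, g s| := by
  rcases le_total a b with hab | hab
  · rw [abs_of_nonneg (intervalIntegral.integral_nonneg hab fun s _ => hg0 s)]
    refine gronwall_integral hg hg0 hx.norm hab fun t ht => ?_
    have := h t (by rwa [uIcc_of_le hab])
    rwa [abs_of_nonneg (intervalIntegral.integral_nonneg ht.1
      fun s _ => mul_nonneg (hg0 s) (norm_nonneg _))] at this
  -- For `b ≤ a`, reverse time.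
  · have hneg : LocallyIntegrable (fun s => g (-s)) volume :=
      locallyIntegrable_of_intervalIntegrable fun p q => by
        exact (IntervalIntegrable.iff_comp_neg (by simp)).2 (by simpa using hg.intervalIntegrable' (-p) (-q))
    have key := gronwall_integral (u := fun s => ‖x (-s)‖) (a := -a) (b := -b) (c := c) hneg
      (fun s => hg0 _) (hx.comp continuous_neg).norm (by linarith) (fun t ht => by
        have hta : -t ≤ a := by linarith [ht.1]
        have := h (-t) (by rw [uIcc_of_ge hab]; exact ⟨by linarith [ht.2], hta⟩)
        rw [intervalIntegral.integral_symm, abs_neg,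
          abs_of_nonneg (intervalIntegral.integral_nonneg hta
            fun s _ => mul_nonneg (hg0 s) (norm_nonneg _))] at this
        rw [intervalIntegral.integral_comp_neg (fun s => g s * ‖x s‖), neg_neg]
        exact this)
    simp only [neg_neg] at key
    rw [intervalIntegral.integral_comp_neg, neg_neg, neg_neg] at key
    rwa [intervalIntegral.integral_symm, abs_neg,
      abs_of_nonneg (intervalIntegral.integral_nonneg hab fun s _ => hg0 s)]

end Calculus

/-! ### Linear equations with locally integrable coefficients -/

section LinearEquation

variable {V : Type*} [NormedAddCommGroup V] [NormedSpace ℝ V]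
variable {E : Type*} [NormedAddCommGroup E] [NormedSpace ℝ E]

omit [NormedSpace ℝ E] in
theorem _root_.MeasureTheory.LocallyIntegrable.norm' {f : ℝ → E}
    (hf : LocallyIntegrable f volume) : LocallyIntegrable (fun s => ‖f s‖) volume :=
  fun x => (hf x).norm

theorem _root_.MeasureTheory.LocallyIntegrable.clm_comp {F : Type*} [NormedAddCommGroup F]
    [NormedSpace ℝ F] {f : ℝ → E} (hf : LocallyIntegrable f volume) (L : E →L[ℝ] F) :
    LocallyIntegrable (fun s => L (f s)) volume := fun x => by
  obtain ⟨S, hS, hi⟩ := hf x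
  exact ⟨S, hS, L.integrable_comp hi⟩

/-- A weight whose logarithmic derivative dominates a multiple of `g`. -/
theorem abs_integral_mul_exp_le {g : ℝ → ℝ} (hg : LocallyIntegrable g volume)
    (hg0 : ∀ s, 0 ≤ g s) (a t : ℝ) :
    |∫ s in a..t, g s * Real.exp (2 * |∫ τ in a..s, g τ|)| ≤
      Real.exp (2 * |∫ τ in a..t, g τ|) / 2 := by
  have hg2 : LocallyIntegrable (fun s => 2 * g s) volume := hg.smul (2 : ℝ)
  have hgm : LocallyIntegrable (fun s => (-2) * g s) volume := hg.smul (-2 : ℝ)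
  have e2 : ∀ s, Real.exp (∫ τ in a..s, 2 * g τ) = Real.exp (2 * ∫ τ in a..s, g τ) := fun s => by
    rw [intervalIntegral.integral_const_mul]
  have em : ∀ s, Real.exp (∫ τ in a..s, -2 * g τ) = Real.exp (-2 * ∫ τ in a..s, g τ) := fun s => by
    rw [intervalIntegral.integral_const_mul]
  rcases le_total a t with hat | hat
  · have hp : ∀ s, a ≤ s → |∫ τ in a..s, g τ| = ∫ τ in a..s, g τ := fun s hs =>
      abs_of_nonneg (intervalIntegral.integral_nonneg hs fun s _ => hg0 s)
    have h1 : ∫ s in a..t, g s * Real.exp (2 * |∫ τ in a..s, g τ|) =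
        (Real.exp (2 * ∫ τ in a..t, g τ) - 1) / 2 := by
      have := integral_mul_exp hg2 a a t
      simp only [e2, intervalIntegral.integral_same, Real.exp_zero] at this
      rw [← this, ← intervalIntegral.integral_div]
      refine intervalIntegral.integral_congr fun s hs => ?_
      rw [uIcc_of_le hat] at hs
      simp only [hp s hs.1]; ring
    rw [h1, hp t hat, abs_of_nonneg]
    · linarith
    · have : 0 ≤ ∫ τ in a..t, g τ := intervalIntegral.integral_nonneg hat fun s _ => hg0 s
      have := Real.one_le_exp (x := 2 * ∫ τ in a..t, g τ) (by linarith)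
      linarith
  · have hp : ∀ s, s ≤ a → |∫ τ in a..s, g τ| = -∫ τ in a..s, g τ := fun s hs => by
      rw [intervalIntegral.integral_symm, neg_neg, abs_neg,
        abs_of_nonneg (intervalIntegral.integral_nonneg hs fun s _ => hg0 s)]
    have h1 : ∫ s in a..t, g s * Real.exp (2 * |∫ τ in a..s, g τ|) =
        -((Real.exp (-2 * ∫ τ in a..t, g τ) - 1) / 2) := by
      have := integral_mul_exp hgm a a t
      simp only [em, intervalIntegral.integral_same, Real.exp_zero] at this
      rw [← this, ← intervalIntegral.integral_div, ← intervalIntegral.integral_neg]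
      refine intervalIntegral.integral_congr fun s hs => ?_
      rw [uIcc_of_ge hat] at hs
      simp only [hp s hs.2]
      rw [show 2 * -(∫ τ in a..s, g τ) = -2 * ∫ τ in a..s, g τ by ring]; ring
    have h0 : 0 ≤ -∫ τ in a..t, g τ := by rw [← hp t hat]; exact abs_nonneg _
    rw [h1, hp t hat, abs_neg, abs_of_nonneg]
    · rw [show 2 * -(∫ τ in a..t, g τ) = -2 * ∫ τ in a..t, g τ by ring]
      linarith
    · have := Real.one_le_exp (x := -2 * ∫ τ in a..t, g τ) (by linarith)
      linarith

/-- Global existence for linear equations with locally integrable coefficients. -/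
theorem exists_linear_solution [CompleteSpace E] {L : ℝ → E →L[ℝ] E}
    (hL : LocallyIntegrable L volume) (a : ℝ) (x₀ : E) :
    ∃ x : ℝ → E, Continuous x ∧ ∀ t, x t = x₀ + ∫ s in a..t, L s (x s) := by
  set g : ℝ → ℝ := fun s => ‖L s‖ with hg
  have hgi : LocallyIntegrable g volume := hL.norm'
  have hg0 : ∀ s, 0 ≤ g s := fun s => norm_nonneg _
  -- Writing `x = w y` amounts to using a weighted sup norm. Since `|∫ g w| ≤ w / 2`, the Picard map
  -- for `y` is a `1/2`-contraction on the whole line at once, and no continuation of local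
  -- solutions is needed.
  set w : ℝ → ℝ := fun t => Real.exp (2 * |∫ s in a..t, g s|) with hw
  have hwc : Continuous w :=
    Real.continuous_exp.comp (continuous_const.mul (hgi.continuous_primitive' a).abs)
  have hw1 : ∀ t, 1 ≤ w t := fun t => Real.one_le_exp (by positivity)
  have hw0 : ∀ t, 0 < w t := fun t => Real.exp_pos _
  have hgw : LocallyIntegrable (fun s => g s * w s) volume :=
    hgi.bilin_continuous (ContinuousLinearMap.mul ℝ ℝ) hwc
  have hLy : ∀ y : ℝ → E, Continuous y → LocallyIntegrable (fun s => L s (w s • y s)) volume :=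
    fun y hy => hL.clm_apply (hwc.smul hy)
  have hest : ∀ y : ℝ → E, ∀ C : ℝ, 0 ≤ C → (∀ t, ‖y t‖ ≤ C) →
      ∀ t, ‖(w t)⁻¹ • ∫ s in a..t, L s (w s • y s)‖ ≤ C / 2 := by
    intro y C hC hy t
    rw [norm_smul, norm_inv, Real.norm_of_nonneg (hw0 t).le]
    have h1 : ‖∫ s in a..t, L s (w s • y s)‖ ≤ |∫ s in a..t, C * (g s * w s)| := by
      refine intervalIntegral.norm_integral_le_abs_of_norm_le (Eventually.of_forall fun s => ?_)
        ((hgw.smul C).intervalIntegrable' _ _)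
      calc ‖L s (w s • y s)‖ ≤ ‖L s‖ * ‖w s • y s‖ := (L s).le_opNorm _
        _ = ‖L s‖ * (w s * ‖y s‖) := by rw [norm_smul, Real.norm_of_nonneg (hw0 s).le]
        _ ≤ ‖L s‖ * (w s * C) := by have := hw0 s; gcongr; exact hy s
        _ = C * (g s * w s) := by simp only [hg]; ring
    rw [intervalIntegral.integral_const_mul, abs_mul, abs_of_nonneg hC] at h1
    have h2 := abs_integral_mul_exp_le hgi hg0 a t
    rw [inv_mul_le_iff₀ (hw0 t)]
    calc _ ≤ C * |∫ s in a..t, g s * w s| := h1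
      _ ≤ C * (w t / 2) := by gcongr
      _ = _ := by ring
  let S : BoundedContinuousFunction ℝ E → BoundedContinuousFunction ℝ E := fun y =>
    BoundedContinuousFunction.ofNormedAddCommGroup
      (fun t => (w t)⁻¹ • x₀ + (w t)⁻¹ • ∫ s in a..t, L s (w s • y s))
      (((hwc.inv₀ fun t => (hw0 t).ne').smul continuous_const).add
        ((hwc.inv₀ fun t => (hw0 t).ne').smul ((hLy y y.continuous).continuous_primitive' a)))
      (‖x₀‖ + ‖y‖ / 2) (fun t => by
        refine (norm_add_le _ _).trans (add_le_add ?_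
          (hest y ‖y‖ (norm_nonneg _) y.norm_coe_le_norm t))
        rw [norm_smul, norm_inv, Real.norm_of_nonneg (hw0 t).le]
        exact mul_le_of_le_one_left (norm_nonneg _) (inv_le_one_of_one_le₀ (hw1 t)))
  have hS : ContractingWith (1 / 2) S := by
    refine ⟨by rw [← NNReal.coe_lt_coe]; norm_num, LipschitzWith.of_dist_le_mul fun y y' => ?_⟩
    rw [BoundedContinuousFunction.dist_le (by positivity)]
    intro t
    have e : S y t - S y' t = (w t)⁻¹ • ∫ s in a..t, L s (w s • (y s - y' s)) := by
      simp only [S, BoundedContinuousFunction.coe_ofNormedAddCommGroup, add_sub_add_left_eq_sub]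
      rw [← smul_sub, ← intervalIntegral.integral_sub
        ((hLy y y.continuous).intervalIntegrable' _ _)
        ((hLy y' y'.continuous).intervalIntegrable' _ _)]
      simp [smul_sub]
    rw [dist_eq_norm, e]
    refine (hest (fun s => y s - y' s) (dist y y') dist_nonneg (fun s => ?_) t).trans ?_
    · rw [← dist_eq_norm]; exact BoundedContinuousFunction.dist_coe_le_dist s
    · norm_num; linarith
  obtain ⟨y, hy⟩ : ∃ y, S y = y := ⟨_, hS.fixedPoint_isFixedPt⟩
  refine ⟨fun t => w t • y t, hwc.smul y.continuous, fun t => ?_⟩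
  have h1 : y t = (w t)⁻¹ • x₀ + (w t)⁻¹ • ∫ s in a..t, L s (w s • y s) := by
    conv_lhs => rw [← hy]
    rfl
  simp only []
  conv_lhs => rw [h1]
  rw [← smul_add, smul_inv_smul₀ (hw0 t).ne']

/-- Two solutions of a linear integral equation with the same forcing term agree. -/
theorem linear_solution_unique {L : ℝ → E →L[ℝ] E} (hL : LocallyIntegrable L volume)
    {a b : ℝ} {p : ℝ → E} {x y : ℝ → E} (hx : Continuous x) (hy : Continuous y)
    (hxe : ∀ t ∈ uIcc a b, x t = p t + ∫ s in a..t, L s (x s))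
    (hye : ∀ t ∈ uIcc a b, y t = p t + ∫ s in a..t, L s (y s)) :
    x b = y b := by
  have key := norm_le_of_le_abs_integral (x := fun t => x t - y t) (a := a) (b := b) (c := 0)
    hL.norm' (fun _ => norm_nonneg _) (hx.sub hy) fun t ht => by
      rw [hxe t ht, hye t ht, add_sub_add_left_eq_sub, zero_add,
        ← intervalIntegral.integral_sub ((hL.clm_apply hx).intervalIntegrable' _ _)
        ((hL.clm_apply hy).intervalIntegrable' _ _)]
      refine intervalIntegral.norm_integral_le_abs_of_norm_le (Eventually.of_forall fun s => ?_)
        ((hL.norm'.bilin_continuous (ContinuousLinearMap.mul ℝ ℝ)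
          (hx.sub hy).norm).intervalIntegrable' _ _)
      rw [← map_sub]
      exact (L s).le_opNorm _
  rw [zero_mul] at key
  exact sub_eq_zero.1 (norm_le_zero_iff.1 key)

variable {M : ℝ → V →L[ℝ] V}

theorem locallyIntegrable_mul {A B : ℝ → V →L[ℝ] V} (hA : LocallyIntegrable A volume)
    (hB : Continuous B) : LocallyIntegrable (fun s => A s * B s) volume :=
  hA.bilin_continuous (ContinuousLinearMap.mul ℝ (V →L[ℝ] V)) hB

theorem locallyIntegrable_continuous_mul {A B : ℝ → V →L[ℝ] V} (hB : LocallyIntegrable B volume)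
    (hA : Continuous A) : LocallyIntegrable (fun s => A s * B s) volume :=
  hB.bilin_continuous (ContinuousLinearMap.mul ℝ (V →L[ℝ] V)).flip hA

/-- Operator solutions of `x' = M(t) x` are determined by their value at one point. -/
theorem operator_solution_unique (hM : LocallyIntegrable M volume) {a : ℝ} {C : V →L[ℝ] V}
    {X Y : ℝ → V →L[ℝ] V} (hX : Continuous X) (hY : Continuous Y)
    (hXe : ∀ t, X t = C + ∫ s in a..t, M s * X s)
    (hYe : ∀ t, Y t = C + ∫ s in a..t, M s * Y s) : X = Y := by
  -- The operator equation is a vector equation in `V →L[ℝ] V` whose coefficient is left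
  -- multiplication by `M s`.
  have hL : LocallyIntegrable (fun s => ContinuousLinearMap.compL ℝ V V V (M s)) volume :=
    hM.clm_comp _
  funext b
  exact linear_solution_unique hL (a := a) (p := fun _ => C) hX hY (fun t _ => hXe t)
    (fun t _ => hYe t)

theorem exists_operator_solution [CompleteSpace V] (hM : LocallyIntegrable M volume) (a : ℝ) :
    ∃ X : ℝ → V →L[ℝ] V, Continuous X ∧ ∀ t, X t = 1 + ∫ s in a..t, M s * X s := by
  have hL : LocallyIntegrable (fun s => ContinuousLinearMap.compL ℝ V V V (M s)) volume :=
    hM.clm_comp _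
  exact exists_linear_solution hL a 1

theorem isFundamental_fundamental [CompleteSpace V] (hM : LocallyIntegrable M volume) :
    IsFundamental M (fundamental M) :=
  Classical.epsilon_spec (exists_operator_solution hM 0)

theorem fundamental_sub [CompleteSpace V] (hM : LocallyIntegrable M volume) (a t : ℝ) :
    fundamental M t = fundamental M a + ∫ s in a..t, M s * fundamental M s := by
  obtain ⟨hc, he⟩ := isFundamental_fundamental hM
  have hi := locallyIntegrable_mul hM hc
  rw [he t, he a, add_assoc, intervalIntegral.integral_add_adjacent_intervals
    (hi.intervalIntegrable' _ _) (hi.intervalIntegrable' _ _)]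

/-- The solution of `X' = M X`, `X(a) = 1`, multiplied by the fundamental operator at `a`. -/
theorem fundamental_eq_mul [CompleteSpace V] (hM : LocallyIntegrable M volume) {a : ℝ}
    {X : ℝ → V →L[ℝ] V} (hX : Continuous X) (hXe : ∀ t, X t = 1 + ∫ s in a..t, M s * X s)
    (t : ℝ) : fundamental M t = X t * fundamental M a := by
  have hi := locallyIntegrable_mul hM hX
  refine congrFun (operator_solution_unique hM (a := a) (C := fundamental M a)
    (Y := fun t => X t * fundamental M a)
    (isFundamental_fundamental hM).1 (hX.mul continuous_const) (fundamental_sub hM a)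
    fun t => ?_) t
  have e : ∫ s in a..t, M s * (X s * fundamental M a) =
      (∫ s in a..t, M s * X s) * fundamental M a := by
    simp only [← mul_assoc]
    exact ((ContinuousLinearMap.mul ℝ (V →L[ℝ] V)).flip
      (fundamental M a)).intervalIntegral_comp_comm (hi.intervalIntegrable' a t)
  rw [e]
  conv_lhs => rw [hXe t, add_mul, one_mul]

/-- If `X` solves the equation with `X(a) = 1`, uniqueness gives both `Φ(t) = X(t) Φ(a)` and `X(t) =
Φ(t) X(0)`. Evaluating at `0` and at `a` shows that `X(0)` is a left and a right inverse of `Φ(a)`;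
without finite dimension both are needed. -/
theorem isUnit_fundamental [CompleteSpace V] (hM : LocallyIntegrable M volume) (a : ℝ) :
    IsUnit (fundamental M a) := by
  have h0 : fundamental M 0 = 1 := by simpa using (isFundamental_fundamental hM).2 0
  obtain ⟨X, hX, hXe⟩ := exists_operator_solution hM a
  have h1 : X 0 * fundamental M a = 1 := by rw [← fundamental_eq_mul hM hX hXe, h0]
  have hXa : X a = 1 := by simpa using hXe a
  have h2 : fundamental M a * X 0 = 1 := by
    have := operator_solution_unique hM (a := 0) (C := X 0) (X := X)
      (Y := fun t => fundamental M t * X 0) hX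
      ((isFundamental_fundamental hM).1.mul continuous_const) (fun t => ?_) (fun t => ?_)
    · have h3 := congrFun this a
      rw [← h3, hXa]
    · have hi := locallyIntegrable_mul hM hX
      rw [hXe t, hXe 0, add_assoc, intervalIntegral.integral_add_adjacent_intervals
        (hi.intervalIntegrable' _ _) (hi.intervalIntegrable' _ _)]
    · have hi := locallyIntegrable_mul hM (isFundamental_fundamental hM).1
      have e : ∫ s in (0:ℝ)..t, M s * (fundamental M s * X 0) =
          (∫ s in (0:ℝ)..t, M s * fundamental M s) * X 0 := by
        simp only [← mul_assoc]
        exact ((ContinuousLinearMap.mul ℝ (V →L[ℝ] V)).flip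
          (X 0)).intervalIntegral_comp_comm (hi.intervalIntegrable' 0 t)
      rw [e]
      conv_lhs => rw [(isFundamental_fundamental hM).2 t, add_mul, one_mul]
  exact ⟨⟨fundamental M a, X 0, h2, h1⟩, rfl⟩

section Evolution

variable [CompleteSpace V] (hM : LocallyIntegrable M volume)
include hM

theorem evolution_self (t : ℝ) : evolution M t t = 1 :=
  Ring.mul_inverse_cancel _ (isUnit_fundamental hM t)

theorem evolution_mul_evolution (t s r : ℝ) :
    evolution M t s * evolution M s r = evolution M t r := by
  rw [evolution, evolution, evolution, mul_assoc, ← mul_assoc (Ring.inverse _),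
    Ring.inverse_mul_cancel _ (isUnit_fundamental hM s), one_mul]

theorem continuous_inverse_fundamental : Continuous fun s => Ring.inverse (fundamental M s) := by
  rw [continuous_iff_continuousAt]
  intro s
  obtain ⟨u, hu⟩ := isUnit_fundamental hM s
  have := NormedRing.inverse_continuousAt u
  rw [hu] at this
  exact ContinuousAt.comp (f := fundamental M) this (isFundamental_fundamental hM).1.continuousAt

theorem continuous_evolution_left (s : ℝ) : Continuous fun t => evolution M t s :=
  (isFundamental_fundamental hM).1.mul continuous_const

theorem continuous_evolution_right (t : ℝ) : Continuous fun s => evolution M t s :=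
  continuous_const.mul (continuous_inverse_fundamental hM)

theorem evolution_eq_integral (t s : ℝ) :
    evolution M t s = 1 + ∫ τ in s..t, M τ * evolution M τ s := by
  obtain ⟨X, hX, hXe⟩ := exists_operator_solution hM s
  have : ∀ t, evolution M t s = X t := fun t => by
    rw [evolution, fundamental_eq_mul hM hX hXe t, mul_assoc,
      Ring.mul_inverse_cancel _ (isUnit_fundamental hM s), mul_one]
  simp only [this]
  exact hXe t

theorem norm_evolution_le (t s : ℝ) :
    ‖evolution M t s‖ ≤ Real.exp |∫ τ in s..t, ‖M τ‖| := by
  have key := norm_le_of_le_abs_integral (x := fun t => evolution M t s) (a := s) (b := t)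
    (c := 1) hM.norm' (fun _ => norm_nonneg _) (continuous_evolution_left hM s) fun t _ => by
      rw [evolution_eq_integral hM t s]
      refine (norm_add_le _ _).trans (add_le_add ContinuousLinearMap.norm_id_le ?_)
      refine intervalIntegral.norm_integral_le_abs_of_norm_le
        (Eventually.of_forall fun s => norm_mul_le _ _)
        ((hM.norm'.bilin_continuous (ContinuousLinearMap.mul ℝ ℝ)
          (continuous_evolution_left hM s).norm).intervalIntegrable' _ _)
  rwa [one_mul] at key

/-- The variation of constants formula. -/
theorem variation_of_constants {f : ℝ → V} (hf : LocallyIntegrable f volume) (a : ℝ) (x : V) :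
    let u := fun t => evolution M t a x + ∫ s in a..t, evolution M t s (f s)
    Continuous u ∧ ∀ t, u t = x + ∫ s in a..t, (M s (u s) + f s) := by
  intro u
  have hΦ := continuous_evolution_left hM a
  have hg : LocallyIntegrable (fun s => evolution M a s (f s)) volume :=
    hf.continuous_clm_apply (continuous_evolution_right hM a)
  set v : ℝ → V := fun t => x + ∫ s in a..t, evolution M a s (f s) with hv
  have hvc : Continuous v := continuous_const.add (hg.continuous_primitive' a)
  -- Factoring out `Φ(t,a)` leaves an integrand independent of `t`, so the product rule applies.
  have huv : ∀ t, u t = evolution M t a (v t) := fun t => by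
    simp only [u, hv, map_add]
    rw [← ContinuousLinearMap.intervalIntegral_comp_comm _ (hg.intervalIntegrable' a t)]
    simp only [← mul_apply_eq_comp, evolution_mul_evolution hM]
  have huc : Continuous u := by
    rw [show u = _ from funext huv]; exact hΦ.clm_apply hvc
  refine ⟨huc, fun t => ?_⟩
  have key := integral_bilin (ContinuousLinearMap.id ℝ (V →L[ℝ] V))
    (f := fun t => evolution M t a) (g := v) (a := a) (locallyIntegrable_mul hM hΦ) hg
    (fun t => by rw [evolution_self hM]; exact evolution_eq_integral hM t a)
    (fun t => by simp [hv]) t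
  have e1 : v a = x := by simp [hv]
  simp only [ContinuousLinearMap.id_apply, evolution_self hM, mul_apply_eq_comp, ← huv,
    e1, one_apply_eq_self] at key
  rw [key]
  congr 1
  refine intervalIntegral.integral_congr fun s _ => ?_
  simp only [← mul_apply_eq_comp, evolution_mul_evolution hM, evolution_self hM,
    one_apply_eq_self]

end Evolution

end LinearEquation

/-! ### The grid and its index function -/

section Grid

variable {T ζ : ℤ → ℝ} {γ : ℝ → ℝ} {θ : ℝ}

theorem PiecewiseArgument.strictMono (hA : PiecewiseArgument T ζ γ θ) : StrictMono T :=
  strictMono_int_of_lt_succ hA.grid_lt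

theorem PiecewiseArgument.exists_mem_Ico (hA : PiecewiseArgument T ζ γ θ) (t : ℝ) :
    ∃ i, t ∈ Ico (T i) (T (i + 1)) := by
  obtain ⟨b, hb⟩ := (hA.tendsto_top.eventually_gt_atTop t).exists
  obtain ⟨a, ha⟩ := (hA.tendsto_bot.eventually_le_atBot t).exists
  obtain ⟨i, hi, hmax⟩ := Int.exists_greatest_of_bdd (P := fun i => T i ≤ t)
    ⟨b, fun z hz => (hA.strictMono.lt_iff_lt.1 (hz.trans_lt hb)).le⟩ ⟨a, ha⟩
  refine ⟨i, hi, not_le.1 fun h => ?_⟩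
  have := hmax _ h
  omega

theorem PiecewiseArgument.mem_gridIndex (hA : PiecewiseArgument T ζ γ θ) (t : ℝ) :
    t ∈ Ico (T (gridIndex T t)) (T (gridIndex T t + 1)) :=
  Classical.epsilon_spec (hA.exists_mem_Ico t)

theorem PiecewiseArgument.gridIndex_eq (hA : PiecewiseArgument T ζ γ θ) {t : ℝ} {i : ℤ}
    (h : t ∈ Ico (T i) (T (i + 1))) : gridIndex T t = i := by
  have h' := hA.mem_gridIndex t
  have h1 := hA.strictMono.lt_iff_lt.1 (h.1.trans_lt h'.2)
  have h2 := hA.strictMono.lt_iff_lt.1 (h'.1.trans_lt h.2)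
  omega

end Grid

/-- Two-sided recursion in a group. -/
theorem exists_int_recursion {G : Type*} [Group G] (S : ℤ → G) :
    ∃ Y : ℤ → G, ∀ i, Y (i + 1) = S i * Y i := by
  refine ⟨fun i => Int.inductionOn' (motive := fun _ => G) i 0 1 (fun k _ y => S k * y)
    (fun k _ y => (S (k - 1))⁻¹ * y), fun i => ?_⟩
  rcases le_or_gt 0 i with hi | hi
  · exact Int.inductionOn'_add_one hi
  · have h := Int.inductionOn'_sub_one (motive := fun _ => G) (zero := 1)
      (succ := fun k _ y => S k * y) (pred := fun k _ y => (S (k - 1))⁻¹ * y) (z := i + 1)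
      (b := 0) (by omega)
    have e : i + 1 - 1 = i := by ring
    rw [e] at h
    beta_reduce
    rw [h, mul_inv_cancel_left]

/-! ### Invertibility of `E(t, ζ j)` and the cocycle form of the transition operator -/

section Node

variable {V : Type*} [NormedAddCommGroup V] [NormedSpace ℝ V] [CompleteSpace V]
variable {M M₀ : ℝ → V →L[ℝ] V}

theorem nodeEvolution_eq_mul (hM : LocallyIntegrable M volume) (hM₀ : LocallyIntegrable M₀ volume)
    (t τ : ℝ) : nodeEvolution M M₀ t τ =
      evolution M t τ * (1 + ∫ s in τ..t, evolution M τ s * M₀ s) := by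
  rw [nodeEvolution, mul_add, mul_one]
  have hi := locallyIntegrable_continuous_mul hM₀ (continuous_evolution_right hM τ)
  have := (ContinuousLinearMap.compL ℝ V V V (evolution M t τ)).intervalIntegral_comp_comm
    (hi.intervalIntegrable' τ t)
  refine congrArg _ (Eq.trans ?_ this)
  refine intervalIntegral.integral_congr fun s _ => ?_
  change _ = evolution M t τ * (evolution M τ s * M₀ s)
  rw [← mul_assoc, evolution_mul_evolution hM]

theorem nodeEvolution_self (hM : LocallyIntegrable M volume) (τ : ℝ) :
    nodeEvolution M M₀ τ τ = 1 := by
  simp [nodeEvolution, evolution_self hM]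

/-- `E(t,τ) d` is the response of `x' = M x` to the initial value `d` and the constant-state forcing
`M₀ d`. This reduces the delayed equation on one grid interval to ordinary variation of constants.
-/
theorem nodeEvolution_apply_add (hM : LocallyIntegrable M volume)
    (hM₀ : LocallyIntegrable M₀ volume) {f : ℝ → V} (hf : LocallyIntegrable f volume)
    (t τ : ℝ) (d : V) :
    nodeEvolution M M₀ t τ d + ∫ s in τ..t, evolution M t s (f s) =
      evolution M t τ d + ∫ s in τ..t, evolution M t s (M₀ s d + f s) := by
  have hi := locallyIntegrable_continuous_mul hM₀ (continuous_evolution_right hM t)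
  have hd : LocallyIntegrable (fun s => evolution M t s (M₀ s d)) volume :=
    (hM₀.clm_apply continuous_const).continuous_clm_apply (continuous_evolution_right hM t)
  have hf' := hf.continuous_clm_apply (continuous_evolution_right hM t)
  simp only [map_add]
  rw [intervalIntegral.integral_add (hd.intervalIntegrable' _ _) (hf'.intervalIntegrable' _ _),
    nodeEvolution, add_apply, add_assoc]
  congr 2
  rw [ContinuousLinearMap.intervalIntegral_apply (hi.intervalIntegrable' _ _)]
  rfl

/-- Neumann series: `E(t,τ)` is `Φ(t,τ)` times `1 + ∫ Φ(τ,s) M₀(s) ds`, and the hypothesis makes the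
norm of this integral less than `1`. -/
theorem isUnit_nodeEvolution_of_lt (hM : LocallyIntegrable M volume)
    (hM₀ : LocallyIntegrable M₀ volume) {t τ : ℝ}
    (h : Real.exp |∫ s in τ..t, ‖M s‖| * |∫ s in τ..t, ‖M₀ s‖| < 1) :
    IsUnit (nodeEvolution M M₀ t τ) := by
  rw [nodeEvolution_eq_mul hM hM₀]
  refine ((isUnit_fundamental hM t).mul (isUnit_fundamental hM τ).ringInverse).mul ?_
  have hle : ‖∫ s in τ..t, evolution M τ s * M₀ s‖ < 1 := by
    refine lt_of_le_of_lt ?_ h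
    rw [← abs_of_pos (Real.exp_pos |∫ s in τ..t, ‖M s‖|), ← abs_mul,
      ← intervalIntegral.integral_const_mul]
    refine intervalIntegral.norm_integral_le_abs_of_norm_le ?_
      ((hM₀.norm'.smul (_ : ℝ)).intervalIntegrable' _ _)
    filter_upwards [ae_restrict_mem measurableSet_uIoc] with s hs
    refine (norm_mul_le _ _).trans (mul_le_mul_of_nonneg_right ?_ (norm_nonneg _))
    refine (norm_evolution_le hM τ s).trans ?_
    rw [Real.exp_le_exp]
    refine intervalIntegral.abs_integral_mono_interval ?_
      (Eventually.of_forall fun _ => norm_nonneg _) (hM.norm'.intervalIntegrable' _ _)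
    rw [uIoc_comm s τ]
    rcases le_total τ t with h | h
    · rw [uIoc_of_le h] at hs ⊢
      rw [uIoc_of_le hs.1.le]
      exact Ioc_subset_Ioc_right hs.2
    · rw [uIoc_of_ge h] at hs ⊢
      rw [uIoc_of_ge hs.2]
      exact Ioc_subset_Ioc_left hs.1.le
  have := isUnit_one_sub_of_norm_lt_one (x := -∫ s in τ..t, evolution M τ s * M₀ s)
    (by rwa [norm_neg])
  rwa [sub_neg_eq_add] at this

variable {T ζ : ℤ → ℝ} {γ : ℝ → ℝ} {θ νp νm : ℝ}

/-- The quantities in the Neumann criterion grow as `t` moves away from the node. At the end of the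
interval they are `ρ_j^±(M)` and `ln ρ_j^±(M₀)`, with product at most `ν^± < 1`. -/
theorem isUnit_nodeEvolution (hA : PiecewiseArgument T ζ γ θ) (hM : LocallyIntegrable M volume)
    (hM₀ : LocallyIntegrable M₀ volume) (hC : SmallnessCondition T ζ M M₀ νp νm) {j : ℤ} {t : ℝ}
    (ht : t ∈ Icc (T j) (T (j + 1))) : IsUnit (nodeEvolution M M₀ t (ζ j)) := by
  refine isUnit_nodeEvolution_of_lt hM hM₀ ?_
  have mono : ∀ {Q : ℝ → V →L[ℝ] V} (_ : LocallyIntegrable Q volume) (b : ℝ),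
      uIoc (ζ j) t ⊆ uIoc (ζ j) b → |∫ s in ζ j..t, ‖Q s‖| ≤ |∫ s in ζ j..b, ‖Q s‖| :=
    fun hQ b hb => intervalIntegral.abs_integral_mono_interval hb
      (Eventually.of_forall fun _ => norm_nonneg _) (hQ.norm'.intervalIntegrable' _ _)
  have hζ := hA.node_mem j
  rcases le_total (ζ j) t with h | h
  · have hs : uIoc (ζ j) t ⊆ uIoc (ζ j) (T (j + 1)) := by
      rw [uIoc_of_le h, uIoc_of_le hζ.2]; exact Ioc_subset_Ioc_right ht.2
    have hp : ∀ Q : ℝ → V →L[ℝ] V, |∫ s in ζ j..T (j + 1), ‖Q s‖| = ∫ s in ζ j..T (j + 1), ‖Q s‖ :=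
      fun Q => abs_of_nonneg (intervalIntegral.integral_nonneg hζ.2 fun _ _ => norm_nonneg _)
    refine lt_of_le_of_lt ?_ hC.nu_minus_mem.2
    refine le_trans ?_ (hC.minus_le j)
    rw [rhoMinus, rhoMinus, Real.log_exp, ← hp M, ← hp M₀]
    exact mul_le_mul (Real.exp_le_exp.2 (mono hM _ hs)) (mono hM₀ _ hs) (abs_nonneg _)
      (Real.exp_pos _).le
  · have hs : uIoc (ζ j) t ⊆ uIoc (ζ j) (T j) := by
      rw [uIoc_of_ge h, uIoc_of_ge hζ.1]; exact Ioc_subset_Ioc_left ht.1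
    have hp : ∀ Q : ℝ → V →L[ℝ] V, |∫ s in ζ j..T j, ‖Q s‖| = ∫ s in T j..ζ j, ‖Q s‖ :=
      fun Q => by
        rw [intervalIntegral.integral_symm, abs_neg]
        exact abs_of_nonneg (intervalIntegral.integral_nonneg hζ.1 fun _ _ => norm_nonneg _)
    refine lt_of_le_of_lt ?_ hC.nu_plus_mem.2
    refine le_trans ?_ (hC.plus_le j)
    rw [rhoPlus, rhoPlus, Real.log_exp, ← hp M, ← hp M₀]
    exact mul_le_mul (Real.exp_le_exp.2 (mono hM _ hs)) (mono hM₀ _ hs) (abs_nonneg _)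
      (Real.exp_pos _).le

/-- The transition operator is `W(t) W(s)⁻¹` for a family of invertible operators that is a
multiple of `E(t, ζ j)` on every closed grid interval. -/
theorem exists_transition_units (hA : PiecewiseArgument T ζ γ θ) (hM : LocallyIntegrable M volume)
    (hM₀ : LocallyIntegrable M₀ volume) (hC : SmallnessCondition T ζ M M₀ νp νm) :
    ∃ (W : ℝ → (V →L[ℝ] V)ˣ) (D : ℤ → V →L[ℝ] V),
      (∀ j, ∀ t ∈ Icc (T j) (T (j + 1)), (W t : V →L[ℝ] V) = nodeEvolution M M₀ t (ζ j) * D j) ∧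
      ∀ t s, transition T ζ M M₀ t s = ((W t * (W s)⁻¹ : (V →L[ℝ] V)ˣ) : V →L[ℝ] V) := by
  have hE : ∀ j t, t ∈ Icc (T j) (T (j + 1)) → IsUnit (nodeEvolution M M₀ t (ζ j)) :=
    fun j t ht => isUnit_nodeEvolution hA hM hM₀ hC ht
  have hex : ∀ j : ℤ, ∃ e : ℝ → (V →L[ℝ] V)ˣ, ∀ t ∈ Icc (T j) (T (j + 1)),
      (e t : V →L[ℝ] V) = nodeEvolution M M₀ t (ζ j) := fun j => by
    classical
    refine ⟨fun t => if h : t ∈ Icc (T j) (T (j + 1)) then (hE j t h).unit else 1,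
      fun t ht => ?_⟩
    beta_reduce
    rw [dif_pos ht]
    exact IsUnit.unit_spec _
  choose e he using hex
  have hl : ∀ j, T j ∈ Icc (T j) (T (j + 1)) := fun j => left_mem_Icc.2 (hA.grid_lt j).le
  have hr : ∀ j, T (j + 1) ∈ Icc (T j) (T (j + 1)) := fun j => right_mem_Icc.2 (hA.grid_lt j).le
  -- `Y j` is to be the value of `W` at `T j`; the recursion multiplies by the transition across one
  -- grid interval.
  obtain ⟨Y, hY⟩ := exists_int_recursion fun j => e j (T (j + 1)) * (e j (T j))⁻¹
  set D : ℤ → (V →L[ℝ] V)ˣ := fun j => (e j (T j))⁻¹ * Y j with hD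
  set W : ℝ → (V →L[ℝ] V)ˣ := fun t => e (gridIndex T t) t * D (gridIndex T t) with hW
  -- The right endpoint has grid index `j + 1`; there the two formulas agree by the recursion for
  -- `Y`.
  have hWe : ∀ j, ∀ t ∈ Icc (T j) (T (j + 1)), W t = e j t * D j := by
    intro j t ht
    rcases ht.2.lt_or_eq with h | h
    · simp only [hW, hA.gridIndex_eq ⟨ht.1, h⟩]
    · rw [h]
      have : gridIndex T (T (j + 1)) = j + 1 := hA.gridIndex_eq ⟨le_rfl, hA.grid_lt _⟩
      simp only [hW, this, hD, hY, mul_inv_cancel_left]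
      group
  have hloc : ∀ j, ∀ t ∈ Icc (T j) (T (j + 1)), ∀ s ∈ Icc (T j) (T (j + 1)),
      localTransition ζ M M₀ j t s = ((W t * (W s)⁻¹ : (V →L[ℝ] V)ˣ) : V →L[ℝ] V) := by
    intro j t ht s hs
    rw [localTransition, ← he j t ht, ← he j s hs, Ring.inverse_unit, ← Units.val_mul,
      hWe j t ht, hWe j s hs]
    congr 1
    group
  have hup : ∀ i n, productUp T ζ M M₀ i n =
      ((W (T (i + (n : ℕ))) * (W (T i))⁻¹ : (V →L[ℝ] V)ˣ) : V →L[ℝ] V) := by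
    intro i n
    induction n with
    | zero => simp [productUp]
    | succ n ih =>
      rw [productUp, ih, hloc _ _ (hr _) _ (hl _), ← Units.val_mul]
      rw [Nat.cast_add_one, ← add_assoc]
      congr 1
      group
  have hdown : ∀ i n, productDown T ζ M M₀ i n =
      ((W (T i) * (W (T (i + (n : ℕ))))⁻¹ : (V →L[ℝ] V)ˣ) : V →L[ℝ] V) := by
    intro i n
    induction n with
    | zero => simp [productDown]
    | succ n ih =>
      rw [productDown, ih, hloc _ _ (hl _) _ (hr _), ← Units.val_mul]
      rw [Nat.cast_add_one, ← add_assoc]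
      congr 1
      group
  refine ⟨W, fun j => D j, fun j t ht => ?_, fun t s => ?_⟩
  · rw [hWe j t ht, Units.val_mul, he j t ht]
  · have ht := Ico_subset_Icc_self (hA.mem_gridIndex t)
    have hs := Ico_subset_Icc_self (hA.mem_gridIndex s)
    simp only [transition]
    split_ifs with h1 h2
    · rw [← h1] at ht
      exact hloc _ _ ht _ hs
    · rw [hloc _ _ ht _ (hl _), hloc _ _ (hr _) _ hs, hup, ← Units.val_mul, ← Units.val_mul]
      have : gridIndex T s + 1 + ((gridIndex T t - gridIndex T s - 1).toNat : ℤ) =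
          gridIndex T t := by omega
      rw [this]
      congr 1
      group
    · rw [hloc _ _ ht _ (hr _), hloc _ _ (hl _) _ hs, hdown, ← Units.val_mul, ← Units.val_mul]
      have : gridIndex T t + 1 + ((gridIndex T s - gridIndex T t - 1).toNat : ℤ) =
          gridIndex T s := by omega
      rw [this]
      congr 1
      group

end Node

/-! ### Anchors and the integral of the decay kernel -/

section Anchor

/-- The index of the grid point at which the Green operator is anchored for the argument `s`. -/
def anchor (T ζ : ℤ → ℝ) (s : ℝ) : ℤ :=
  if s < ζ (gridIndex T s) then gridIndex T s else gridIndex T s + 1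

variable {T ζ : ℤ → ℝ} {γ : ℝ → ℝ} {θ : ℝ}

theorem PiecewiseArgument.measurable_gridIndex (hA : PiecewiseArgument T ζ γ θ) :
    Measurable (gridIndex T) := by
  refine measurable_to_countable' fun i => ?_
  have : gridIndex T ⁻¹' {i} = Ico (T i) (T (i + 1)) := by
    ext t
    refine ⟨fun h => ?_, fun h => hA.gridIndex_eq h⟩
    have h1 : gridIndex T t = i := h
    rw [← h1]; exact hA.mem_gridIndex t
  rw [this]; exact measurableSet_Ico

theorem PiecewiseArgument.arg_eq_node (hA : PiecewiseArgument T ζ γ θ) (t : ℝ) :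
    γ t = ζ (gridIndex T t) := hA.arg_eq _ _ (hA.mem_gridIndex t)

theorem PiecewiseArgument.measurable_arg (hA : PiecewiseArgument T ζ γ θ) : Measurable γ := by
  rw [show γ = ζ ∘ gridIndex T from funext hA.arg_eq_node]
  exact (Measurable.of_discrete).comp hA.measurable_gridIndex

theorem PiecewiseArgument.measurable_anchor (hA : PiecewiseArgument T ζ γ θ) :
    Measurable (anchor T ζ) := by
  have h := hA.measurable_gridIndex
  refine Measurable.ite (measurableSet_lt measurable_id
    ((Measurable.of_discrete (f := ζ)).comp h)) h ?_
  exact (Measurable.of_discrete (f := fun i : ℤ => i + 1)).comp h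

/-- Each `s` between two consecutive nodes is anchored at the grid point between them. Thus
comparing anchors means comparing `s` with nodes, which identifies the `s` for which `Z_P` switches
branch at a given grid point. -/
theorem PiecewiseArgument.lt_node_iff (hA : PiecewiseArgument T ζ γ θ) {s : ℝ} {j : ℤ} :
    s < ζ j ↔ anchor T ζ s ≤ j := by
  have hs := hA.mem_gridIndex s
  have hm := hA.strictMono
  have hj := hA.node_mem j
  unfold anchor
  generalize gridIndex T s = r at *
  constructor
  · intro h
    have h1 : r < j + 1 := hm.lt_iff_lt.1 (hs.1.trans_lt (h.trans_le hj.2))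
    split_ifs with h2
    · omega
    · have : r ≠ j := by rintro rfl; exact h2 h
      omega
  · intro h
    by_contra h1
    push Not at h1
    have h2 : j < r + 1 := hm.lt_iff_lt.1 ((hj.1.trans h1).trans_lt hs.2)
    split_ifs at h with h3
    · have : r = j := by omega
      subst this
      exact absurd h3 (not_lt.2 h1)
    · omega

theorem PiecewiseArgument.anchor_eq (hA : PiecewiseArgument T ζ γ θ) {s : ℝ} {j : ℤ}
    (h : s ∈ Ico (ζ j) (ζ (j + 1))) : anchor T ζ s = j + 1 := by
  have h1 := hA.lt_node_iff.1 h.2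
  have h2 := (not_congr hA.lt_node_iff).1 (not_lt.2 h.1)
  omega

theorem anchor_eq_or (s : ℝ) :
    anchor T ζ s = gridIndex T s ∨ anchor T ζ s = gridIndex T s + 1 := by
  unfold anchor; split_ifs <;> simp

/-- By convexity the graph of `δ ↦ exp(-αδ)` on `[0, θ]` lies below its chord. The bound turns
interval lengths into telescoping differences. -/
theorem le_mul_one_sub_exp {α θ δ : ℝ} (hα : 0 < α) (hθ : 0 < θ) (h0 : 0 ≤ δ) (h1 : δ ≤ θ) :
    δ ≤ θ / (1 - Real.exp (-(α * θ))) * (1 - Real.exp (-(α * δ))) := by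
  have he : Real.exp (-(α * θ)) < 1 := by rw [← Real.exp_zero, Real.exp_lt_exp]; nlinarith
  rw [div_mul_eq_mul_div, le_div_iff₀ (by linarith)]
  have hc := convexOn_exp.2 (mem_univ (-(α * θ))) (mem_univ 0)
    (show 0 ≤ δ / θ by positivity) (show 0 ≤ 1 - δ / θ by rw [sub_nonneg, div_le_one hθ]; exact h1) (by ring)
  simp only [smul_eq_mul, mul_zero, add_zero, Real.exp_zero, mul_one] at hc
  have e : δ / θ * -(α * θ) = -(α * δ) := by field_simp
  rw [e] at hc
  have e2 : θ * (δ / θ * Real.exp (-(α * θ)) + (1 - δ / θ)) = δ * Real.exp (-(α * θ)) + θ - δ := by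
    field_simp; ring
  have := mul_le_mul_of_nonneg_left hc hθ.le
  rw [e2] at this
  linarith

/-- The difference of the two sides vanishes at `0`, and since `x ≤ exp x - 1` its derivative is at
least `(exp x - 1)²`. -/
theorem three_mul_exp_le {x : ℝ} (hx : 0 ≤ x) :
    x * (3 * Real.exp x - 1) ≤ 2 * Real.exp x * (Real.exp x - 1) := by
  let g : ℝ → ℝ := fun x => 2 * Real.exp x * (Real.exp x - 1) - x * (3 * Real.exp x - 1)
  have hd : ∀ x, HasDerivAt g (2 * Real.exp x * (Real.exp x - 1) + 2 * Real.exp x * Real.exp x -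
      (1 * (3 * Real.exp x - 1) + x * (3 * Real.exp x))) x := fun x =>
    (((Real.hasDerivAt_exp x).const_mul 2).mul ((Real.hasDerivAt_exp x).sub_const 1)).sub
      ((hasDerivAt_id x).mul (((Real.hasDerivAt_exp x).const_mul 3).sub_const 1))
  have hm : MonotoneOn g (Ici 0) := by
    refine monotoneOn_of_deriv_nonneg (convex_Ici 0)
      (fun x _ => (hd x).continuousAt.continuousWithinAt)
      (fun x _ => (hd x).differentiableAt.differentiableWithinAt) fun x hx => ?_
    rw [interior_Ici] at hx
    rw [(hd x).deriv]
    have h1 := Real.add_one_le_exp x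
    have h2 := Real.exp_pos x
    nlinarith [sq_nonneg (Real.exp x - 1), mul_le_mul_of_nonneg_right h1 h2.le]
  have := hm (mem_Ici.2 le_rfl) (mem_Ici.2 hx) hx
  simp only [g, Real.exp_zero] at this
  linarith

/-- The term with factor `2` bounds the main part of the Green operator and `θ` the local part. The
crude estimate `|t - T k| ≥ |t - s| - θ` would spend all of `2 exp(αθ)/α` on the main part alone. -/
theorem two_mul_add_le {α θ : ℝ} (hα : 0 < α) (hθ : 0 < θ) :
    2 * (θ / (1 - Real.exp (-(α * θ)))) + θ ≤ 2 * Real.exp (α * θ) / α := by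
  have h := three_mul_exp_le (mul_pos hα hθ).le
  have hy : 1 < Real.exp (α * θ) := Real.one_lt_exp_iff.2 (mul_pos hα hθ)
  rw [Real.exp_neg]
  set y := Real.exp (α * θ) with hy'
  have e : 2 * (θ / (1 - y⁻¹)) + θ = (α * θ * (3 * y - 1)) / (y - 1) / α := by
    have h1 : y - 1 ≠ 0 := by linarith
    have h2 : y ≠ 0 := by linarith
    have h3 : 1 - y⁻¹ = (y - 1) / y := by field_simp
    rw [h3]
    field_simp
    ring
  rw [e]
  refine div_le_div_of_nonneg_right ?_ hα.le
  rw [div_le_iff₀ (by linarith)]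
  exact h

theorem measurable_exp_anchor (hA : PiecewiseArgument T ζ γ θ) (α t : ℝ) :
    Measurable fun s => Real.exp (-α * |t - T (anchor T ζ s)|) :=
  (Measurable.of_discrete (f := fun k : ℤ => Real.exp (-α * |t - T k|))).comp
    hA.measurable_anchor

/-- The decay kernel frozen at the anchors is integrable, uniformly in `t`. -/
theorem integrable_exp_anchor (hA : PiecewiseArgument T ζ γ θ) {α : ℝ} (hα : 0 < α) (t : ℝ) :
    Integrable (fun s => Real.exp (-α * |t - T (anchor T ζ s)|)) ∧
      ∫ s, Real.exp (-α * |t - T (anchor T ζ s)|) ≤ 2 * (θ / (1 - Real.exp (-(α * θ)))) := by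
  set a : ℝ → ℝ := fun s => Real.exp (-α * |t - T (anchor T ζ s)|) with ha
  set φ := θ / (1 - Real.exp (-(α * θ))) with hφ
  have hθ := hA.theta_pos
  have hφ0 : 0 ≤ φ := div_nonneg hθ.le
    (sub_nonneg.2 (Real.exp_le_one_iff.2 (by nlinarith)))
  have hm := hA.strictMono.monotone
  have ham : Measurable a := measurable_exp_anchor hA α t
  have ha1 : ∀ s, a s ≤ 1 := fun s =>
    Real.exp_le_one_iff.2 (by have := abs_nonneg (t - T (anchor T ζ s)); nlinarith)
  have hai : LocallyIntegrable a volume := by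
    refine (locallyIntegrable_const (1 : ℝ)).mono ham.aestronglyMeasurable
      (Eventually.of_forall fun s => ?_)
    rw [Real.norm_of_nonneg (Real.exp_pos _).le, norm_one]
    exact ha1 s
  have hpiece : ∀ r c, (∀ s ∈ Ico (T r) (T (r + 1)), a s ≤ c) →
      ∫ s in T r..T (r + 1), a s ≤ (T (r + 1) - T r) * c := by
    intro r c hc
    have := intervalIntegral.integral_mono_on_of_le_Ioo (hA.grid_lt r).le
      (hai.intervalIntegrable' _ _) intervalIntegrable_const
      (fun s hs => hc s (Ioo_subset_Ico_self hs))
    simpa using this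
  have hanchor : ∀ r, ∀ s ∈ Ico (T r) (T (r + 1)),
      anchor T ζ s = r ∨ anchor T ζ s = r + 1 := fun r s hs => by
    rw [← hA.gridIndex_eq hs]; exact anchor_eq_or s
  have hδ : ∀ x y, x ≤ y → y - x ≤ θ → ∀ z, (y - x) * Real.exp (-(α * (x - z))) ≤
      φ * (Real.exp (-(α * (x - z))) - Real.exp (-(α * (y - z)))) := by
    intro x y hxy hθ' z
    have h1 := le_mul_one_sub_exp hα hθ (sub_nonneg.2 hxy) hθ'
    have h2 := mul_le_mul_of_nonneg_right h1 (Real.exp_pos (-(α * (x - z)))).le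
    refine h2.trans (le_of_eq ?_)
    rw [mul_assoc, sub_mul, one_mul, ← Real.exp_add]
    congr 3
    ring_nf
  obtain ⟨j, hj⟩ := hA.exists_mem_Ico t
  -- The interval of `t`, where the kernel is at most `1`, is split at `t`. Its two lengths supply
  -- the first terms of the telescoping sums to the right and to the left, each of total at most
  -- `φ`.
  have hu := le_mul_one_sub_exp hα hθ (sub_nonneg.2 hj.2.le)
    (by linarith [hA.length_le j, hj.1])
  have hv := le_mul_one_sub_exp hα hθ (sub_nonneg.2 hj.1)
    (by linarith [hA.length_le j, hj.2])
  rw [← hφ] at hu hv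
  have hbound : ∀ n : ℕ, ∫ s in T (j - n)..T (j + 1 + n), a s ≤ (T (j + 1) - T j) +
      φ * (Real.exp (-(α * (T (j + 1) - t))) - Real.exp (-(α * (T (j + 1 + n) - t)))) +
      φ * (Real.exp (-(α * (t - T j))) - Real.exp (-(α * (t - T (j - n))))) := by
    intro n
    induction n with
    | zero =>
      have := hpiece j 1 fun s _ => ha1 s
      simpa using this
    | succ n ih =>
      -- Anchors lie at an endpoint of the interval of `s`, so the endpoint nearer to `t` bounds the
      -- kernel on each new interval.
      have hr : ∫ s in T (j + 1 + n)..T (j + 1 + n + 1), a s ≤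
          φ * (Real.exp (-(α * (T (j + 1 + n) - t))) -
            Real.exp (-(α * (T (j + 1 + n + 1) - t)))) := by
        refine (hpiece _ (Real.exp (-(α * (T (j + 1 + n) - t)))) fun s hs => ?_).trans
          (hδ _ _ (hA.grid_lt _).le (hA.length_le _) t)
        rw [ha, Real.exp_le_exp, neg_mul, neg_le_neg_iff]
        refine mul_le_mul_of_nonneg_left ?_ hα.le
        have h1 : T (j + 1 + n) ≤ T (anchor T ζ s) := by
          rcases hanchor _ s hs with h | h <;> rw [h]
          exact hm (by omega)
        have := neg_le_abs (t - T (anchor T ζ s))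
        linarith
      have hl : ∫ s in T (j - n - 1)..T (j - n - 1 + 1), a s ≤
          φ * (Real.exp (-(α * (t - T (j - n)))) - Real.exp (-(α * (t - T (j - n - 1))))) := by
        refine (hpiece _ (Real.exp (-(α * (t - T (j - n))))) fun s hs => ?_).trans ?_
        · rw [ha, Real.exp_le_exp, neg_mul, neg_le_neg_iff]
          refine mul_le_mul_of_nonneg_left ?_ hα.le
          have h1 : T (anchor T ζ s) ≤ T (j - n) := by
            rcases hanchor _ s hs with h | h <;> rw [h] <;> exact hm (by omega)
          have := le_abs_self (t - T (anchor T ζ s))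
          linarith
        · have hlen := hA.length_le (j - n - 1)
          have hlt := hA.grid_lt (j - n - 1)
          rw [sub_add_cancel] at hlen hlt ⊢
          have := hδ (-T (j - n)) (-T (j - n - 1)) (by linarith) (by linarith) (-t)
          simp only [sub_neg_eq_add] at this
          rw [show t - T (j - n) = -T (j - n) + t by ring,
            show t - T (j - n - 1) = -T (j - n - 1) + t by ring,
            show T (j - n) - T (j - n - 1) = -T (j - n - 1) + T (j - n) by ring]
          exact this
      rw [sub_add_cancel] at hl
      have e1 : (j - ((n + 1 : ℕ) : ℤ)) = j - n - 1 := by push_cast; ring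
      have e2 : (j + 1 + ((n + 1 : ℕ) : ℤ)) = j + 1 + n + 1 := by push_cast; ring
      rw [e1, e2]
      have hsplit : ∫ s in T (j - n - 1)..T (j + 1 + n + 1), a s =
          (∫ s in T (j - n - 1)..T (j - n), a s) + (∫ s in T (j - n)..T (j + 1 + n), a s) +
            ∫ s in T (j + 1 + n)..T (j + 1 + n + 1), a s := by
        rw [intervalIntegral.integral_add_adjacent_intervals (hai.intervalIntegrable' _ _)
          (hai.intervalIntegrable' _ _), intervalIntegral.integral_add_adjacent_intervals
          (hai.intervalIntegrable' _ _) (hai.intervalIntegrable' _ _)]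
      rw [hsplit]
      linarith
  have hbound' : ∀ n : ℕ, ∫ s in T (j - n)..T (j + 1 + n), a s ≤ 2 * φ := by
    intro n
    refine (hbound n).trans ?_
    have h1 := mul_nonneg hφ0 (Real.exp_pos (-(α * (T (j + 1 + n) - t)))).le
    have h2 := mul_nonneg hφ0 (Real.exp_pos (-(α * (t - T (j - n))))).le
    linarith
  have hlo : Tendsto (fun n : ℕ => T (j - n)) atTop atBot := hA.tendsto_bot.comp
    (tendsto_atBot_add_const_left _ j (tendsto_neg_atTop_atBot.comp tendsto_natCast_atTop_atTop))
  have hhi : Tendsto (fun n : ℕ => T (j + 1 + n)) atTop atTop := hA.tendsto_top.comp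
    (tendsto_atTop_add_const_left _ (j + 1) tendsto_natCast_atTop_atTop)
  have hint : Integrable a := by
    refine integrable_of_intervalIntegral_norm_bounded (2 * φ)
      (fun n => (intervalIntegrable_iff_integrableOn_Ioc_of_le (hm (by omega))).1
        (hai.intervalIntegrable' _ _)) hlo hhi (Eventually.of_forall fun n => ?_)
    refine le_trans (le_of_eq ?_) (hbound' n)
    refine intervalIntegral.integral_congr fun s _ => ?_
    exact Real.norm_of_nonneg (Real.exp_pos _).le
  exact ⟨hint, le_of_tendsto' (intervalIntegral_tendsto_integral hint hlo hhi) hbound'⟩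

end Anchor

/-! ### The Green operator: jumps, measurability and norm bound -/

section Green

variable {V : Type*} [NormedAddCommGroup V] [NormedSpace ℝ V]

/-- The part of the Green operator that is anchored at the grid. -/
def greenMain (T ζ : ℤ → ℝ) (M M₀ : ℝ → V →L[ℝ] V) (P : V →L[ℝ] V) (t s : ℝ) : V →L[ℝ] V :=
  transitionP T ζ M M₀ P t (T (anchor T ζ s)) * evolution M (T (anchor T ζ s)) s

/-- The part of the Green operator supported between `t` and the node of its interval. -/
def greenLocal (T ζ : ℤ → ℝ) (M : ℝ → V →L[ℝ] V) (t s : ℝ) : V →L[ℝ] V :=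
  if ζ (gridIndex T t) ≤ s ∧ s < t then evolution M t s
  else if t ≤ s ∧ s < ζ (gridIndex T t) then -evolution M t s
  else 0

variable {T ζ : ℤ → ℝ} {γ : ℝ → ℝ} {θ νp νm : ℝ} {M M₀ : ℝ → V →L[ℝ] V} {P : V →L[ℝ] V} {K α : ℝ}

theorem green_eq_add (t s : ℝ) :
    green T ζ M M₀ P t s = greenMain T ζ M M₀ P t s + greenLocal T ζ M t s := by
  unfold green greenMain greenLocal anchor
  simp only []
  congr 1
  split_ifs <;> rfl

theorem green_apply (t s : ℝ) (x : V) : green T ζ M M₀ P t s x =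
    greenMain T ζ M M₀ P t s x + greenLocal T ζ M t s x := by
  rw [green_eq_add]; rfl

/-- As long as the first argument does not cross `s`, the same branch of `Z_P` applies and the
cocycle property moves it. -/
theorem transitionP_of_iff {W : ℝ → (V →L[ℝ] V)ˣ}
    (hW : ∀ t s, transition T ζ M M₀ t s = ((W t * (W s)⁻¹ : (V →L[ℝ] V)ˣ) : V →L[ℝ] V))
    {t t' s : ℝ} (h : s ≤ t ↔ s ≤ t') :
    transitionP T ζ M M₀ P t s =
      ((W t * (W t')⁻¹ : (V →L[ℝ] V)ˣ) : V →L[ℝ] V) * transitionP T ζ M M₀ P t' s := by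
  have e : transition T ζ M M₀ t 0 =
      ((W t * (W t')⁻¹ : (V →L[ℝ] V)ˣ) : V →L[ℝ] V) * transition T ζ M M₀ t' 0 := by
    rw [hW, hW, ← Units.val_mul]; congr 1; group
  unfold transitionP
  by_cases h1 : s ≤ t'
  · rw [if_pos (h.2 h1), if_pos h1, e, mul_assoc, mul_assoc, mul_assoc]
  · rw [if_neg (h.not.2 h1), if_neg h1, e, mul_neg, mul_assoc, mul_assoc, mul_assoc]

/-- The jump on the diagonal: the branches with `P` and with `-(1 - P)` differ by `Z(t,0) Z(0,t) =
1`. -/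
theorem transitionP_self_of_lt {W : ℝ → (V →L[ℝ] V)ˣ}
    (hW : ∀ t s, transition T ζ M M₀ t s = ((W t * (W s)⁻¹ : (V →L[ℝ] V)ˣ) : V →L[ℝ] V))
    {t t' : ℝ} (h : t' < t) :
    transitionP T ζ M M₀ P t t =
      ((W t * (W t')⁻¹ : (V →L[ℝ] V)ˣ) : V →L[ℝ] V) * transitionP T ζ M M₀ P t' t + 1 := by
  have e : transition T ζ M M₀ t 0 =
      ((W t * (W t')⁻¹ : (V →L[ℝ] V)ˣ) : V →L[ℝ] V) * transition T ζ M M₀ t' 0 := by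
    rw [hW, hW, ← Units.val_mul]; congr 1; group
  have e1 : transition T ζ M M₀ t 0 * transition T ζ M M₀ 0 t = 1 := by
    rw [hW, hW, ← Units.val_mul, ← Units.val_one]; congr 1; group
  unfold transitionP
  rw [if_pos le_rfl, if_neg (not_le.2 h), mul_neg, ← mul_assoc, ← mul_assoc, ← e]
  rw [mul_sub, mul_one, sub_mul, e1]
  abel

/-- Anchors are grid points, so none is crossed while `t` moves inside `[T j, T (j+1))`. -/
theorem greenMain_eq_mul (hA : PiecewiseArgument T ζ γ θ) {W : ℝ → (V →L[ℝ] V)ˣ}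
    (hW : ∀ t s, transition T ζ M M₀ t s = ((W t * (W s)⁻¹ : (V →L[ℝ] V)ˣ) : V →L[ℝ] V))
    {j : ℤ} {t : ℝ} (ht : t ∈ Ico (T j) (T (j + 1))) (s : ℝ) :
    greenMain T ζ M M₀ P t s =
      ((W t * (W (T j))⁻¹ : (V →L[ℝ] V)ˣ) : V →L[ℝ] V) * greenMain T ζ M M₀ P (T j) s := by
  unfold greenMain
  rw [← mul_assoc, ← transitionP_of_iff hW]
  refine ⟨fun h => ?_, fun h => h.trans ht.1⟩
  have := hA.strictMono.lt_iff_lt.1 (h.trans_lt ht.2)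
  exact hA.strictMono.monotone (by omega)

/-- Reaching `T (j+1)` switches the branch exactly for the `s` anchored there, and the identity jump
of `Z_P` becomes `Φ(T (j+1),s)`. -/
theorem greenMain_succ (hA : PiecewiseArgument T ζ γ θ) {W : ℝ → (V →L[ℝ] V)ˣ}
    (hW : ∀ t s, transition T ζ M M₀ t s = ((W t * (W s)⁻¹ : (V →L[ℝ] V)ˣ) : V →L[ℝ] V))
    (j : ℤ) (s : ℝ) :
    greenMain T ζ M M₀ P (T (j + 1)) s =
      ((W (T (j + 1)) * (W (T j))⁻¹ : (V →L[ℝ] V)ˣ) : V →L[ℝ] V) * greenMain T ζ M M₀ P (T j) s +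
      (Ico (ζ j) (ζ (j + 1))).indicator (fun s => evolution M (T (j + 1)) s) s := by
  unfold greenMain
  by_cases hs : s ∈ Ico (ζ j) (ζ (j + 1))
  · rw [indicator_of_mem hs, hA.anchor_eq hs, transitionP_self_of_lt hW (hA.grid_lt j), add_mul,
      one_mul, mul_assoc]
  · rw [indicator_of_notMem hs, add_zero, ← mul_assoc, ← transitionP_of_iff hW]
    rw [hA.strictMono.le_iff_le, hA.strictMono.le_iff_le, ← hA.lt_node_iff, ← hA.lt_node_iff]
    have : ζ j ≤ ζ (j + 1) := (hA.node_mem j).2.trans (hA.node_mem (j + 1)).1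
    refine ⟨fun h => not_le.1 fun h' => hs ⟨h', h⟩, fun h => h.trans_le this⟩

theorem one_le_rho (hC : SmallnessCondition T ζ M M₀ νp νm)
    (hA : PiecewiseArgument T ζ γ θ) : 1 ≤ rho T ζ M := by
  refine le_trans ?_ (le_ciSup hC.rho_finite 0)
  refine one_le_mul_of_one_le_of_one_le (Real.one_le_exp ?_) (Real.one_le_exp ?_)
  · exact intervalIntegral.integral_nonneg (hA.node_mem 0).1 fun _ _ => norm_nonneg _
  · exact intervalIntegral.integral_nonneg (hA.node_mem 0).2 fun _ _ => norm_nonneg _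

section Complete

variable [CompleteSpace V]

theorem norm_evolution_le_rho (hA : PiecewiseArgument T ζ γ θ) (hM : LocallyIntegrable M volume)
    (hC : SmallnessCondition T ζ M M₀ νp νm) {j : ℤ} {t s : ℝ} (ht : t ∈ Icc (T j) (T (j + 1)))
    (hs : s ∈ Icc (T j) (T (j + 1))) : ‖evolution M t s‖ ≤ rho T ζ M := by
  refine (norm_evolution_le hM t s).trans (le_trans ?_ (le_ciSup hC.rho_finite j))
  rw [rhoPlus, rhoMinus, ← Real.exp_add, Real.exp_le_exp,
    intervalIntegral.integral_add_adjacent_intervals (hM.norm'.intervalIntegrable' _ _)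
    (hM.norm'.intervalIntegrable' _ _), ← abs_of_nonneg (intervalIntegral.integral_nonneg
      (hA.grid_lt j).le fun _ _ => norm_nonneg _)]
  refine intervalIntegral.abs_integral_mono_interval ?_
    (Eventually.of_forall fun _ => norm_nonneg _) (hM.norm'.intervalIntegrable' _ _)
  rw [uIoc_of_le (hA.grid_lt j).le]
  exact Ioc_subset_Ioc (le_min hs.1 ht.1) (max_le hs.2 ht.2)

theorem norm_greenMain_le (hA : PiecewiseArgument T ζ γ θ) (hM : LocallyIntegrable M volume)
    (hC : SmallnessCondition T ζ M M₀ νp νm) (hD : ExpDichotomy T ζ M M₀ P K α) (t s : ℝ) :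
    ‖greenMain T ζ M M₀ P t s‖ ≤
      K * rho T ζ M * Real.exp (-α * |t - T (anchor T ζ s)|) := by
  have hs := hA.mem_gridIndex s
  have h1 : ‖evolution M (T (anchor T ζ s)) s‖ ≤ rho T ζ M := by
    rcases anchor_eq_or (T := T) (ζ := ζ) s with h | h
    · rw [h]
      exact norm_evolution_le_rho hA hM hC (left_mem_Icc.2 (hA.grid_lt _).le)
        (Ico_subset_Icc_self hs)
    · rw [h]
      exact norm_evolution_le_rho hA hM hC (right_mem_Icc.2 (hA.grid_lt _).le)
        (Ico_subset_Icc_self hs)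
  have hK := hD.one_le_K
  calc _ ≤ ‖transitionP T ζ M M₀ P t (T (anchor T ζ s))‖ * ‖evolution M (T (anchor T ζ s)) s‖ :=
        norm_mul_le _ _
    _ ≤ (K * Real.exp (-α * |t - T (anchor T ζ s)|)) * rho T ζ M :=
        mul_le_mul (hD.bound _ _) h1 (norm_nonneg _) (by positivity)
    _ = _ := by ring

/-- Splitting `Φ(T k,s) = Φ(T k) Φ(s)⁻¹` leaves a function of the integer anchor times a continuous
function of `s`. -/
theorem stronglyMeasurable_greenMain (hA : PiecewiseArgument T ζ γ θ)
    (hM : LocallyIntegrable M volume) (t : ℝ) :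
    StronglyMeasurable fun s => greenMain T ζ M M₀ P t s := by
  have h1 : StronglyMeasurable fun s => transitionP T ζ M M₀ P t (T (anchor T ζ s)) *
      fundamental M (T (anchor T ζ s)) :=
    (StronglyMeasurable.of_discrete (f := fun k : ℤ => transitionP T ζ M M₀ P t (T k) *
      fundamental M (T k))).comp_measurable hA.measurable_anchor
  have h2 := (continuous_inverse_fundamental hM).stronglyMeasurable
  have := h1.mul h2
  refine (congrArg StronglyMeasurable (funext fun s => ?_)).mp this
  simp only [Pi.mul_apply, greenMain, evolution, mul_assoc]

/-- The anchored part of the Green operator acts on bounded functions. -/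
theorem integrable_greenMain_apply (hA : PiecewiseArgument T ζ γ θ)
    (hM : LocallyIntegrable M volume) (hC : SmallnessCondition T ζ M M₀ νp νm)
    (hD : ExpDichotomy T ζ M M₀ P K α) {f : ℝ → V} {C : ℝ} (hf : AEStronglyMeasurable f volume)
    (hfC : ∀ s, ‖f s‖ ≤ C) (t : ℝ) :
    Integrable (fun s => greenMain T ζ M M₀ P t s (f s)) ∧
      ‖∫ s, greenMain T ζ M M₀ P t s (f s)‖ ≤
        K * rho T ζ M * C * (2 * (θ / (1 - Real.exp (-(α * θ))))) := by
  obtain ⟨hi, hb⟩ := integrable_exp_anchor hA hD.alpha_pos t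
  have hC0 : 0 ≤ C := (norm_nonneg _).trans (hfC 0)
  have hK : 0 ≤ K := zero_le_one.trans hD.one_le_K
  have hρ : 0 ≤ rho T ζ M := zero_le_one.trans (one_le_rho hC hA)
  have hle : ∀ s, ‖greenMain T ζ M M₀ P t s (f s)‖ ≤
      K * rho T ζ M * C * Real.exp (-α * |t - T (anchor T ζ s)|) := fun s => by
    refine ((greenMain T ζ M M₀ P t s).le_opNorm _).trans ?_
    calc _ ≤ (K * rho T ζ M * Real.exp (-α * |t - T (anchor T ζ s)|)) * C :=
          mul_le_mul (norm_greenMain_le hA hM hC hD t s) (hfC s) (norm_nonneg _) (by positivity)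
      _ = _ := by ring
  have hi' := hi.const_mul (K * rho T ζ M * C)
  refine ⟨hi'.mono' ?_ (Eventually.of_forall hle), ?_⟩
  · exact (ContinuousLinearMap.id ℝ (V →L[ℝ] V)).aestronglyMeasurable_comp₂
      (stronglyMeasurable_greenMain hA hM t).aestronglyMeasurable hf
  · refine (norm_integral_le_of_norm_le hi' (Eventually.of_forall hle)).trans ?_
    rw [integral_const_mul]
    gcongr

/-- The signs in the local part are those of an oriented integral, so both positions of `t` relative
to its node give one formula. -/
theorem integrable_greenLocal_apply (hM : LocallyIntegrable M volume) {f : ℝ → V}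
    (hf : LocallyIntegrable f volume) (t : ℝ) :
    Integrable (fun s => greenLocal T ζ M t s (f s)) ∧
      ∫ s, greenLocal T ζ M t s (f s) = ∫ s in ζ (gridIndex T t)..t, evolution M t s (f s) := by
  have hg : LocallyIntegrable (fun s => evolution M t s (f s)) volume :=
    hf.continuous_clm_apply (continuous_evolution_right hM t)
  unfold greenLocal
  generalize ζ (gridIndex T t) = z
  rcases le_or_gt z t with h | h
  · have e : (fun s => (if z ≤ s ∧ s < t then evolution M t s
        else if t ≤ s ∧ s < z then -evolution M t s else 0) (f s)) =
        (Ico z t).indicator fun s => evolution M t s (f s) := by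
      funext s
      by_cases hs : z ≤ s ∧ s < t
      · rw [if_pos hs, indicator_of_mem (mem_Ico.2 hs)]
      · rw [if_neg hs, indicator_of_notMem (by simpa using hs), if_neg (by
          rintro ⟨h1, h2⟩; linarith)]
        rfl
    rw [e, integrable_indicator_iff measurableSet_Ico, integral_indicator measurableSet_Ico,
      integral_Ico_eq_integral_Ioc, intervalIntegral.integral_of_le h]
    exact ⟨(hg.integrableOn_isCompact isCompact_Icc).mono_set Ico_subset_Icc_self, rfl⟩
  · have e : (fun s => (if z ≤ s ∧ s < t then evolution M t s
        else if t ≤ s ∧ s < z then -evolution M t s else 0) (f s)) =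
        (Ico t z).indicator fun s => -(evolution M t s (f s)) := by
      funext s
      rw [if_neg (by rintro ⟨h1, h2⟩; linarith)]
      by_cases hs : t ≤ s ∧ s < z
      · rw [if_pos hs, indicator_of_mem (mem_Ico.2 hs)]
        rfl
      · rw [if_neg hs, indicator_of_notMem (by simpa using hs)]
        rfl
    rw [e, integrable_indicator_iff measurableSet_Ico, integral_indicator measurableSet_Ico,
      integral_neg, integral_Ico_eq_integral_Ioc, intervalIntegral.integral_of_ge h.le]
    exact ⟨((hg.integrableOn_isCompact isCompact_Icc).mono_set Ico_subset_Icc_self).neg, rfl⟩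

/-- The Green operator maps bounded functions to bounded functions. -/
theorem integrable_green_apply (hA : PiecewiseArgument T ζ γ θ)
    (hM : LocallyIntegrable M volume) (hC : SmallnessCondition T ζ M M₀ νp νm)
    (hD : ExpDichotomy T ζ M M₀ P K α) {f : ℝ → V} {C : ℝ} (hf : LocallyIntegrable f volume)
    (hfC : ∀ s, ‖f s‖ ≤ C) (t : ℝ) :
    Integrable (fun s => green T ζ M M₀ P t s (f s)) ∧
      ‖∫ s, green T ζ M M₀ P t s (f s)‖ ≤ 2 * K * rhoStar T ζ M α θ * α⁻¹ * C := by
  obtain ⟨h1, h2⟩ := integrable_greenMain_apply hA hM hC hD hf.aestronglyMeasurable hfC t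
  obtain ⟨h3, h4⟩ := integrable_greenLocal_apply (T := T) (ζ := ζ) hM hf t
  simp only [green_apply]
  refine ⟨h1.add h3, ?_⟩
  rw [integral_add h1 h3, h4]
  have hC0 : 0 ≤ C := (norm_nonneg _).trans (hfC 0)
  have hK := hD.one_le_K
  have hρ : 0 ≤ rho T ζ M := zero_le_one.trans (one_le_rho hC hA)
  have hθ := hA.theta_pos
  have ht := hA.mem_gridIndex t
  have hz := hA.node_mem (gridIndex T t)
  -- The factor `K ≥ 1` is inserted only to match the bound of the main part.
  have hloc : ‖∫ s in ζ (gridIndex T t)..t, evolution M t s (f s)‖ ≤ K * rho T ζ M * C * θ := by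
    have hle : ∀ s ∈ uIoc (ζ (gridIndex T t)) t, ‖evolution M t s (f s)‖ ≤ rho T ζ M * C := by
      intro s hs
      have hs' : s ∈ Icc (T (gridIndex T t)) (T (gridIndex T t + 1)) := by
        have := uIoc_subset_uIcc hs
        exact ⟨(le_min hz.1 ht.1).trans this.1, this.2.trans (max_le hz.2 ht.2.le)⟩
      refine ((evolution M t s).le_opNorm _).trans (mul_le_mul
        (norm_evolution_le_rho hA hM hC (Ico_subset_Icc_self ht) hs') (hfC s) (norm_nonneg _) hρ)
    refine (intervalIntegral.norm_integral_le_of_norm_le_const hle).trans ?_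
    have hlen : |t - ζ (gridIndex T t)| ≤ θ := by
      have := hA.length_le (gridIndex T t)
      rw [abs_le]; constructor <;> linarith [ht.1, ht.2, hz.1, hz.2]
    calc rho T ζ M * C * |t - ζ (gridIndex T t)| ≤ 1 * rho T ζ M * C * θ := by
          rw [one_mul]; gcongr
      _ ≤ K * rho T ζ M * C * θ := by gcongr
  have hφ := two_mul_add_le hD.alpha_pos hθ
  calc _ ≤ K * rho T ζ M * C * (2 * (θ / (1 - Real.exp (-(α * θ))))) + K * rho T ζ M * C * θ :=
        (norm_add_le _ _).trans (add_le_add h2 hloc)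
    _ = K * rho T ζ M * C * (2 * (θ / (1 - Real.exp (-(α * θ)))) + θ) := by ring
    _ ≤ K * rho T ζ M * C * (2 * Real.exp (α * θ) / α) := by gcongr
    _ = _ := by rw [rhoStar]; ring

end Complete

end Green

/-! ### Gluing along the grid -/

section Gluing

variable {T ζ : ℤ → ℝ} {γ : ℝ → ℝ} {θ : ℝ}

theorem PiecewiseArgument.eq_of_const_on_pieces {β : Type*} (hA : PiecewiseArgument T ζ γ θ)
    {y : ℝ → β} (h : ∀ j, ∀ t ∈ Icc (T j) (T (j + 1)), y t = y (T j)) (t s : ℝ) : y t = y s := by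
  have h0 : ∀ j : ℤ, y (T j) = y (T 0) := by
    intro j
    induction j using Int.induction_on with
    | zero => rfl
    | succ n ih => rw [← ih]; exact h _ _ (right_mem_Icc.2 (hA.grid_lt _).le)
    | pred n ih =>
      rw [← ih]
      have := h (-(n : ℤ) - 1) _ (right_mem_Icc.2 (hA.grid_lt _).le)
      rw [sub_add_cancel] at this
      exact this.symm
  have h1 : ∀ t, y t = y (T 0) := fun t => by
    rw [h _ t (Ico_subset_Icc_self (hA.mem_gridIndex t)), h0]
  rw [h1 t, h1 s]

variable {F : Type*} [NormedAddCommGroup F]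

theorem PiecewiseArgument.locallyIntegrable (hA : PiecewiseArgument T ζ γ θ) {g : ℝ → F}
    (hg : ∀ j, IntervalIntegrable g volume (T j) (T (j + 1))) : LocallyIntegrable g volume := by
  have h1 : ∀ (m : ℤ) (n : ℕ), IntervalIntegrable g volume (T m) (T (m + n)) := fun m n => by
    induction n with
    | zero => simp
    | succ n ih =>
      have := ih.trans (hg (m + n))
      rwa [add_assoc, ← Nat.cast_add_one] at this
  refine locallyIntegrable_of_intervalIntegrable fun a b => ?_
  have ha := hA.mem_gridIndex (min a b)
  have hb := hA.mem_gridIndex (max a b)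
  have hlt := hA.strictMono.lt_iff_lt.1 (ha.1.trans_lt (min_le_max.trans_lt hb.2))
  have h2 := h1 (gridIndex T (min a b)) (gridIndex T (max a b) + 1 - gridIndex T (min a b)).toNat
  rw [show gridIndex T (min a b) +
    ((gridIndex T (max a b) + 1 - gridIndex T (min a b)).toNat : ℤ) = gridIndex T (max a b) + 1 by
    omega] at h2
  refine h2.mono_set ?_
  rw [uIcc_of_le (hA.strictMono.monotone hlt.le)]
  exact Icc_subset_Icc ha.1 hb.2.le

variable [NormedSpace ℝ F]

/-- A function that is an indefinite integral on every closed grid interval is one on the line. -/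
theorem PiecewiseArgument.primitive_of_pieces (hA : PiecewiseArgument T ζ γ θ) {u g : ℝ → F}
    (hg : LocallyIntegrable g volume)
    (hu : ∀ j, ∀ t ∈ Icc (T j) (T (j + 1)), u t - u (T j) = ∫ s in T j..t, g s) :
    Continuous u ∧ ∀ a b, u b - u a = ∫ s in a..b, g s := by
  have hconst := hA.eq_of_const_on_pieces (y := fun t => u t - ∫ s in (0 : ℝ)..t, g s)
    fun j t ht => by
      rw [sub_eq_sub_iff_sub_eq_sub, hu j t ht, intervalIntegral.integral_interval_sub_left
        (hg.intervalIntegrable' _ _) (hg.intervalIntegrable' _ _)]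
  have h2 : ∀ a b, u b - u a = ∫ s in a..b, g s := fun a b => by
    have := hconst b a
    rw [sub_eq_sub_iff_sub_eq_sub, intervalIntegral.integral_interval_sub_left
        (hg.intervalIntegrable' _ _) (hg.intervalIntegrable' _ _)] at this
    exact this
  refine ⟨?_, h2⟩
  have : u = fun t => u 0 + ∫ s in (0 : ℝ)..t, g s := funext fun t => by
    rw [← h2]; abel
  rw [this]
  exact continuous_const.add (hg.continuous_primitive' 0)

end Gluing

/-! ### The linear equation: bounded forcing and absence of bounded homogeneous solutions -/

section Linear

variable {V : Type*} [NormedAddCommGroup V] [NormedSpace ℝ V] [CompleteSpace V]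
variable {T ζ : ℤ → ℝ} {γ : ℝ → ℝ} {θ νp νm : ℝ} {M M₀ : ℝ → V →L[ℝ] V} {P : V →L[ℝ] V} {K α : ℝ}

/-- Variation of constants on a grid interval. -/
theorem nodeEvolution_solution (hM : LocallyIntegrable M volume)
    (hM₀ : LocallyIntegrable M₀ volume) {f : ℝ → V} (hf : LocallyIntegrable f volume)
    (τ : ℝ) (d : V) :
    let v := fun t => nodeEvolution M M₀ t τ d + ∫ s in τ..t, evolution M t s (f s)
    Continuous v ∧ ∀ t, v t = d + ∫ s in τ..t, (M s (v s) + (M₀ s d + f s)) := by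
  intro v
  have hg : LocallyIntegrable (fun s => M₀ s d + f s) volume :=
    (hM₀.clm_apply continuous_const).add hf
  have := variation_of_constants hM hg τ d
  have e : v = fun t => evolution M t τ d + ∫ s in τ..t, evolution M t s (M₀ s d + f s) :=
    funext fun t => nodeEvolution_apply_add hM hM₀ hf t τ d
  rw [← e] at this
  exact this

/-- The Green operator solves the inhomogeneous linear equation. -/
theorem isSolution_green (hA : PiecewiseArgument T ζ γ θ)
    (hM : LocallyIntegrable M volume) (hM₀ : LocallyIntegrable M₀ volume)
    (hC : SmallnessCondition T ζ M M₀ νp νm)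
    (hD : ExpDichotomy T ζ M M₀ P K α) {f : ℝ → V} {C : ℝ} (hf : LocallyIntegrable f volume)
    (hfC : ∀ s, ‖f s‖ ≤ C) :
    IsSolution γ M M₀ (fun t _ _ => f t) (fun t => ∫ s, green T ζ M M₀ P t s (f s)) := by
  obtain ⟨W, D, hWD, hW⟩ := exists_transition_units hA hM hM₀ hC
  set u : ℝ → V := fun t => ∫ s, green T ζ M M₀ P t s (f s) with hu
  have hmain := fun t => (integrable_greenMain_apply hA hM hC hD hf.aestronglyMeasurable hfC t).1
  have hloc := fun t => integrable_greenLocal_apply (T := T) (ζ := ζ) hM hf t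
  have hev : ∀ t, LocallyIntegrable (fun s => evolution M t s (f s)) volume := fun t =>
    hf.continuous_clm_apply (continuous_evolution_right hM t)
  have hu1 : ∀ t, u t = (∫ s, greenMain T ζ M M₀ P t s (f s)) +
      ∫ s in ζ (gridIndex T t)..t, evolution M t s (f s) := fun t => by
    simp only [hu, green_apply]
    rw [integral_add (hmain t) (hloc t).1, (hloc t).2]
  set b : ℤ → V := fun j => ∫ s, greenMain T ζ M M₀ P (T j) s (f s) with hb
  have hl : ∀ j, T j ∈ Icc (T j) (T (j + 1)) := fun j => left_mem_Icc.2 (hA.grid_lt j).le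
  have hbsucc : ∀ j, b (j + 1) = ((W (T (j + 1)) * (W (T j))⁻¹ : (V →L[ℝ] V)ˣ) : V →L[ℝ] V) (b j) +
      ∫ s in ζ j..ζ (j + 1), evolution M (T (j + 1)) s (f s) := by
    intro j
    have hz : ζ j ≤ ζ (j + 1) := (hA.node_mem j).2.trans (hA.node_mem (j + 1)).1
    have e : ∀ s, greenMain T ζ M M₀ P (T (j + 1)) s (f s) =
        ((W (T (j + 1)) * (W (T j))⁻¹ : (V →L[ℝ] V)ˣ) : V →L[ℝ] V)
          (greenMain T ζ M M₀ P (T j) s (f s)) +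
        (Ico (ζ j) (ζ (j + 1))).indicator (fun s => evolution M (T (j + 1)) s (f s)) s := by
      intro s
      rw [greenMain_succ hA hW]
      by_cases hs : s ∈ Ico (ζ j) (ζ (j + 1))
      · simp only [indicator_of_mem hs]; rfl
      · simp only [indicator_of_notMem hs, add_zero]; rfl
    have hi : IntegrableOn (fun s => evolution M (T (j + 1)) s (f s)) (Ico (ζ j) (ζ (j + 1))) :=
      ((hev _).integrableOn_isCompact isCompact_Icc).mono_set Ico_subset_Icc_self
    simp only [hb, e]
    rw [integral_add (ContinuousLinearMap.integrable_comp _ (hmain (T j)))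
      ((integrable_indicator_iff measurableSet_Ico).2 hi),
      ContinuousLinearMap.integral_comp_comm _ (hmain (T j)), integral_indicator measurableSet_Ico,
      integral_Ico_eq_integral_Ioc, intervalIntegral.integral_of_le hz]
  -- At `T (j+1)` the Green operator already uses the node `ζ (j+1)`. The jump integral from `ζ j`
  -- to `ζ (j+1)` restores the base node `ζ j`, so the formula holds on the closed interval.
  have hu2 : ∀ j, ∀ t ∈ Icc (T j) (T (j + 1)), u t =
      ((W t * (W (T j))⁻¹ : (V →L[ℝ] V)ˣ) : V →L[ℝ] V) (b j) +
        ∫ s in ζ j..t, evolution M t s (f s) := by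
    intro j t ht
    rcases ht.2.lt_or_eq with h | h
    · have ht' : t ∈ Ico (T j) (T (j + 1)) := ⟨ht.1, h⟩
      rw [hu1, hA.gridIndex_eq ht', ← ContinuousLinearMap.integral_comp_comm _ (hmain (T j))]
      simp only [greenMain_eq_mul hA hW ht', mul_apply_eq_comp]
    · have hj : gridIndex T (T (j + 1)) = j + 1 := hA.gridIndex_eq ⟨le_rfl, hA.grid_lt _⟩
      rw [h, hu1, hj]
      change b (j + 1) + _ = _
      rw [hbsucc, add_assoc, intervalIntegral.integral_add_adjacent_intervals
        ((hev _).intervalIntegrable' _ _) ((hev _).intervalIntegrable' _ _)]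
  -- `d j` turns out to be `u (ζ j)`, the frozen value seen by `M₀` on the interval.
  set d : ℤ → V := fun j => D j ((((W (T j))⁻¹ : (V →L[ℝ] V)ˣ) : V →L[ℝ] V) (b j)) with hd
  have hu3 : ∀ j, ∀ t ∈ Icc (T j) (T (j + 1)), u t =
      nodeEvolution M M₀ t (ζ j) (d j) + ∫ s in ζ j..t, evolution M t s (f s) := by
    intro j t ht
    rw [hu2 j t ht, Units.val_mul, hWD j t ht]
    rfl
  have hγ : ∀ j, ∀ t ∈ Ico (T j) (T (j + 1)), u (γ t) = d j := by
    intro j t ht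
    rw [hA.arg_eq j t ht, hu3 j _ (hA.node_mem j), nodeEvolution_self hM]
    simp
  have hfield : ∀ j, ∀ t ∈ Ico (T j) (T (j + 1)),
      M t (nodeEvolution M M₀ t (ζ j) (d j) + ∫ s in ζ j..t, evolution M t s (f s)) +
        (M₀ t (d j) + f t) = field γ M M₀ (fun t _ _ => f t) u t := by
    intro j t ht
    rw [field, hγ j t ht, hu3 j t (Ico_subset_Icc_self ht), add_assoc]
  have hli : ∀ j, LocallyIntegrable (fun t =>
      M t (nodeEvolution M M₀ t (ζ j) (d j) + ∫ s in ζ j..t, evolution M t s (f s)) +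
        (M₀ t (d j) + f t)) volume := fun j =>
    (hM.clm_apply (nodeEvolution_solution hM hM₀ hf (ζ j) (d j)).1).add
      ((hM₀.clm_apply continuous_const).add hf)
  have hgl : LocallyIntegrable (field γ M M₀ (fun t _ _ => f t) u) volume := by
    refine hA.locallyIntegrable fun j => ?_
    refine ((hli j).intervalIntegrable' _ _).congr_uIoo fun t ht => ?_
    rw [uIoo_of_le (hA.grid_lt j).le] at ht
    exact hfield j t (Ioo_subset_Ico_self ht)
  have hpieces : ∀ j, ∀ t ∈ Icc (T j) (T (j + 1)),
      u t - u (T j) = ∫ s in T j..t, field γ M M₀ (fun t _ _ => f t) u s := by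
    intro j t ht
    have hv := (nodeEvolution_solution hM hM₀ hf (ζ j) (d j)).2
    beta_reduce at hv
    rw [hu3 j t ht, hu3 j _ (hl j), hv t, hv (T j), add_sub_add_left_eq_sub,
      intervalIntegral.integral_interval_sub_left ((hli j).intervalIntegrable' _ _)
        ((hli j).intervalIntegrable' _ _)]
    refine intervalIntegral.integral_congr_uIoo fun s hs => ?_
    rw [uIoo_of_le ht.1] at hs
    exact hfield j s ⟨hs.1.le, hs.2.trans_le ht.2⟩
  obtain ⟨h1, h2⟩ := hA.primitive_of_pieces hgl hpieces
  exact ⟨h1, fun a b => ⟨hgl.intervalIntegrable' a b, h2 a b⟩⟩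

/-- Solutions of the homogeneous linear equation are propagated by the transition operator. -/
theorem eq_transition_apply (hA : PiecewiseArgument T ζ γ θ)
    (hM : LocallyIntegrable M volume) (hM₀ : LocallyIntegrable M₀ volume)
    (hC : SmallnessCondition T ζ M M₀ νp νm) {w : ℝ → V}
    (hw : IsSolution γ M M₀ (fun _ _ _ => 0) w) (t s : ℝ) :
    w t = transition T ζ M M₀ t s (w s) := by
  obtain ⟨W, D, hWD, hW⟩ := exists_transition_units hA hM hM₀ hC
  have hz : LocallyIntegrable (fun _ : ℝ => (0 : V)) volume := locallyIntegrable_const 0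
  have hnode : ∀ j, ∀ t ∈ Icc (T j) (T (j + 1)),
      w t = nodeEvolution M M₀ t (ζ j) (w (ζ j)) := by
    intro j t ht
    have hv := nodeEvolution_solution hM hM₀ hz (ζ j) (w (ζ j))
    simp only [map_zero, intervalIntegral.integral_zero, add_zero] at hv
    have hd : LocallyIntegrable (fun s => M₀ s (w (ζ j))) volume :=
      hM₀.clm_apply continuous_const
    -- With `w (ζ j)` frozen, both sides solve one ordinary linear equation started at the node, in
    -- either time direction.
    refine linear_solution_unique hM (a := ζ j) (b := t)
      (p := fun t => w (ζ j) + ∫ s in ζ j..t, M₀ s (w (ζ j))) hw.1 hv.1 (fun τ hτ => ?_)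
      (fun τ _ => ?_)
    · have hτ' : ∀ s ∈ uIoo (ζ j) τ, s ∈ Ico (T j) (T (j + 1)) := by
        intro s hs
        have hz := hA.node_mem j
        have h1 : τ ∈ Icc (T j) (T (j + 1)) :=
          ⟨(le_min hz.1 ht.1).trans hτ.1, hτ.2.trans (max_le hz.2 ht.2)⟩
        exact ⟨(le_min hz.1 h1.1).trans hs.1.le, hs.2.trans_le (max_le hz.2 h1.2)⟩
      rw [add_assoc, ← intervalIntegral.integral_add (hd.intervalIntegrable' _ _)
        ((hM.clm_apply hw.1).intervalIntegrable' _ _), ← sub_eq_iff_eq_add', (hw.2 _ _).2]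
      refine intervalIntegral.integral_congr_uIoo fun s hs => ?_
      simp only [field, hA.arg_eq j s (hτ' s hs), add_zero]
      exact add_comm _ _
    · have := hv.2 τ
      rw [add_assoc, ← intervalIntegral.integral_add (hd.intervalIntegrable' _ _)
        ((hM.clm_apply hv.1).intervalIntegrable' _ _)]
      simp only [add_comm (M₀ _ _)]
      exact this
  -- The quantity `W(t)⁻¹ w(t)` is constant on each closed grid interval, hence on the line.
  have hconst := hA.eq_of_const_on_pieces
    (y := fun t => (((W t)⁻¹ : (V →L[ℝ] V)ˣ) : V →L[ℝ] V) (w t)) fun j => by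
      have : ∀ t ∈ Icc (T j) (T (j + 1)), (((W t)⁻¹ : (V →L[ℝ] V)ˣ) : V →L[ℝ] V) (w t) =
          (((W (ζ j))⁻¹ : (V →L[ℝ] V)ˣ) : V →L[ℝ] V) (w (ζ j)) := by
        intro t ht
        have hDζ : D j = (W (ζ j) : V →L[ℝ] V) := by
          rw [hWD j _ (hA.node_mem j), nodeEvolution_self hM, one_mul]
        have hE : nodeEvolution M M₀ t (ζ j) =
            (W t : V →L[ℝ] V) * (((W (ζ j))⁻¹ : (V →L[ℝ] V)ˣ) : V →L[ℝ] V) := by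
          rw [hWD j t ht, hDζ, mul_assoc, Units.mul_inv, mul_one]
        rw [hnode j t ht, hE, ← mul_apply_eq_comp, ← mul_assoc, Units.inv_mul, one_mul]
      intro t ht
      rw [this t ht, this _ (left_mem_Icc.2 (hA.grid_lt j).le)]
  have := hconst t s
  beta_reduce at this
  rw [hW, Units.val_mul, mul_apply_eq_comp, ← this, ← mul_apply_eq_comp, Units.mul_inv,
    one_apply_eq_self]

/-- Under an exponential dichotomy the homogeneous equation has no nonzero bounded solution. -/
theorem eq_zero_of_bounded (hA : PiecewiseArgument T ζ γ θ)
    (hM : LocallyIntegrable M volume) (hM₀ : LocallyIntegrable M₀ volume)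
    (hC : SmallnessCondition T ζ M M₀ νp νm) (hD : ExpDichotomy T ζ M M₀ P K α) {w : ℝ → V}
    (hw : IsSolution γ M M₀ (fun _ _ _ => 0) w) (hb : IsBoundedOnLine w) (t : ℝ) : w t = 0 := by
  obtain ⟨C, hC'⟩ := hb
  have hprop := eq_transition_apply hA hM hM₀ hC hw
  have hK : 0 ≤ K := zero_le_one.trans hD.one_le_K
  have hα := hD.alpha_pos
  have hC0 : 0 ≤ C := (norm_nonneg _).trans (hC' 0)
  have hsmall : ∀ s, ‖transitionP T ζ M M₀ P t s (w s)‖ ≤ K * Real.exp (-α * |t - s|) * C :=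
    fun s => ((transitionP T ζ M M₀ P t s).le_opNorm _).trans
      (mul_le_mul (hD.bound t s) (hC' s) (norm_nonneg _) (by positivity))
  -- For `s ≤ t` this vector equals `Z_P(t,s) w(s)`, whatever `s` is; let `s → -∞`. The
  -- complementary component is treated with `s → +∞`.
  have hstable : transition T ζ M M₀ t 0 (P (w 0)) = 0 := by
    have h1 : ∀ s ≤ t, ‖transition T ζ M M₀ t 0 (P (w 0))‖ ≤ K * Real.exp (-α * |t - s|) * C := by
      intro s hs
      refine le_trans (le_of_eq ?_) (hsmall s)
      rw [transitionP, if_pos hs, hprop 0 s]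
      rfl
    have h2 : Tendsto (fun s => K * Real.exp (-α * |t - s|) * C) atBot (𝓝 (K * 0 * C)) := by
      refine (Tendsto.const_mul K (Real.tendsto_exp_atBot.comp ?_)).mul_const C
      refine Tendsto.const_mul_atTop_of_neg (by linarith) (tendsto_abs_atTop_atTop.comp ?_)
      exact tendsto_atTop_add_const_left _ t tendsto_neg_atBot_atTop
    rw [mul_zero, zero_mul] at h2
    exact norm_le_zero_iff.1 (ge_of_tendsto h2 ((eventually_le_atBot t).mono h1))
  have hunstable : transition T ζ M M₀ t 0 ((1 - P) (w 0)) = 0 := by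
    have h1 : ∀ s, t < s →
        ‖transition T ζ M M₀ t 0 ((1 - P) (w 0))‖ ≤ K * Real.exp (-α * |t - s|) * C := by
      intro s hs
      refine le_trans (le_of_eq ?_) (hsmall s)
      rw [transitionP, if_neg (not_le.2 hs), hprop 0 s, neg_apply, norm_neg]
      rfl
    have h2 : Tendsto (fun s => K * Real.exp (-α * |t - s|) * C) atTop (𝓝 (K * 0 * C)) := by
      refine (Tendsto.const_mul K (Real.tendsto_exp_atBot.comp ?_)).mul_const C
      refine Tendsto.const_mul_atTop_of_neg (by linarith) (tendsto_abs_atBot_atTop.comp ?_)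
      exact tendsto_atBot_add_const_left _ t tendsto_neg_atTop_atBot
    rw [mul_zero, zero_mul] at h2
    exact norm_le_zero_iff.1 (ge_of_tendsto h2 ((eventually_gt_atTop t).mono h1))
  rw [hprop t 0]
  have e : w 0 = P (w 0) + (1 - P) (w 0) := by simp
  rw [e, map_add, hstable, hunstable, add_zero]

end Linear

/-! ### The nonlinear equation: superposition, notions of solution, contraction -/

section Nonlinear

variable {V : Type*} [NormedAddCommGroup V] [NormedSpace ℝ V]
variable {T ζ : ℤ → ℝ} {γ : ℝ → ℝ} {θ νp νm : ℝ} {M M₀ : ℝ → V →L[ℝ] V} {h : ℝ → V → V → V}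
  {r μ ℓ : ℝ} {P : V →L[ℝ] V} {K α : ℝ}

theorem GrowthLipschitz.continuous_uncurry (hB : GrowthLipschitz M M₀ h r μ ℓ) (t : ℝ) :
    Continuous fun p : V × V => h t p.1 p.2 := by
  refine continuous_iff_continuousAt.2 fun p => tendsto_iff_norm_sub_tendsto_zero.2 ?_
  refine squeeze_zero (fun _ => norm_nonneg _) (fun q => hB.lipschitz t q.1 q.2 p.1 p.2) ?_
  have : Continuous fun q : V × V => ℓ * (‖q.1 - p.1‖ + ‖q.2 - p.2‖) := by fun_prop
  simpa using this.tendsto p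

/-- A superposition of the nonlinearity with measurable functions is measurable. -/
theorem GrowthLipschitz.aestronglyMeasurable_comp (hB : GrowthLipschitz M M₀ h r μ ℓ)
    {x y : ℝ → V} (hx : StronglyMeasurable x) (hy : StronglyMeasurable y) :
    AEStronglyMeasurable (fun s => h s (x s) (y s)) volume := by
  have hp := hx.prodMk hy
  -- On each fibre of a simple function the space arguments are fixed, so measurability in time
  -- suffices; continuity in the space arguments then permits passage to the limit.
  have hsimple : ∀ φ : SimpleFunc ℝ (V × V),
      AEStronglyMeasurable (fun s => h s (φ s).1 (φ s).2) volume := by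
    intro φ
    have e : (fun s => h s (φ s).1 (φ s).2) = ∑ c ∈ φ.range,
        (φ ⁻¹' {c}).indicator (fun s => h s c.1 c.2) := by
      funext s
      rw [Finset.sum_apply, Finset.sum_eq_single (φ s)]
      · rw [indicator_of_mem (by simp)]
      · intro c _ hc
        exact indicator_of_notMem (s := φ ⁻¹' {c}) (fun hs => hc (Eq.symm hs)) _
      · intro hs
        exact absurd (φ.mem_range_self s) hs
    rw [e]
    exact Finset.aestronglyMeasurable_sum _ fun c _ =>
      (hB.locInt_h c.1 c.2).aestronglyMeasurable.indicator (φ.measurableSet_fiber c)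
  refine aestronglyMeasurable_of_tendsto_ae atTop (fun n => hsimple (hp.approx n))
    (Eventually.of_forall fun s => ?_)
  exact ((hB.continuous_uncurry s).tendsto (x s, y s)).comp (hp.tendsto_approx s)

omit [NormedSpace ℝ V] in
theorem stronglyMeasurable_comp_arg (hA : PiecewiseArgument T ζ γ θ) {z : ℝ → V}
    (hz : Continuous z) : StronglyMeasurable fun s => z (γ s) :=
  hz.stronglyMeasurable.comp_measurable hA.measurable_arg

theorem GrowthLipschitz.norm_comp_le (hB : GrowthLipschitz M M₀ h r μ ℓ) {z : ℝ → V} {C : ℝ}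
    (hC : ∀ t, ‖z t‖ ≤ C) (s : ℝ) : ‖h s (z s) (z (γ s))‖ ≤ 2 * r * C + μ := by
  have h1 := hB.growth s (z s) (z (γ s))
  have h2 := mul_le_mul_of_nonneg_left (add_le_add (hC s) (hC (γ s))) hB.r_pos.le
  linarith

theorem GrowthLipschitz.locallyIntegrable_comp (hB : GrowthLipschitz M M₀ h r μ ℓ)
    (hA : PiecewiseArgument T ζ γ θ) {z : ℝ → V} (hz : Continuous z) {C : ℝ}
    (hC : ∀ t, ‖z t‖ ≤ C) : LocallyIntegrable (fun s => h s (z s) (z (γ s))) volume := by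
  refine (locallyIntegrable_const (2 * r * C + μ)).mono
    (hB.aestronglyMeasurable_comp hz.stronglyMeasurable (stronglyMeasurable_comp_arg hA hz))
    (Eventually.of_forall fun s => ?_)
  exact (hB.norm_comp_le hC s).trans (le_abs_self _)

theorem GrowthLipschitz.locallyIntegrable_field (hB : GrowthLipschitz M M₀ h r μ ℓ)
    (hA : PiecewiseArgument T ζ γ θ) {z : ℝ → V} (hz : Continuous z) {C : ℝ}
    (hC : ∀ t, ‖z t‖ ≤ C) : LocallyIntegrable (field γ M M₀ h z) volume :=
  ((hB.locInt_M.clm_apply hz).add (hB.locInt_M₀.bilin (ContinuousLinearMap.id ℝ (V →L[ℝ] V))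
    (stronglyMeasurable_comp_arg hA hz).aestronglyMeasurable fun _ _ => ⟨C, fun _ _ => hC _⟩)).add
    (hB.locallyIntegrable_comp hA hz hC)

/-- A bounded classical solution is a solution in the sense of Carathéodory. -/
theorem IsClassicalSolution.isSolution [CompleteSpace V] (hA : PiecewiseArgument T ζ γ θ)
    (hB : GrowthLipschitz M M₀ h r μ ℓ) {w : ℝ → V} (hw : IsClassicalSolution T γ M M₀ h w)
    (hb : IsBoundedOnLine w) : IsSolution γ M M₀ h w := by
  obtain ⟨C, hC⟩ := hb
  have hi := hB.locallyIntegrable_field hA hw.1 hC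
  refine ⟨hw.1, fun a b => ⟨hi.intervalIntegrable' a b, ?_⟩⟩
  -- The grid is countable, so continuity of `w` is enough at its points.
  refine (integral_eq_of_hasDerivAt_off_countable w _ (countable_range T)
    hw.1.continuousOn (fun x hx => ?_) (hi.intervalIntegrable' a b)).symm
  have h1 := hA.mem_gridIndex x
  refine hw.2.1 _ x ⟨h1.1.lt_of_ne fun h => hx.2 ⟨_, h⟩, h1.2⟩

theorem continuousOn_field (hA : PiecewiseArgument T ζ γ θ)
    (hB : GrowthLipschitz M M₀ h r μ ℓ) (hc : PiecewiseContinuousData T M M₀ h) {z : ℝ → V}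
    (hz : Continuous z) (j : ℤ) : ContinuousOn (field γ M M₀ h z) (Ico (T j) (T (j + 1))) := by
  obtain ⟨h1, h2, h3⟩ := hc j
  have hh : ContinuousOn (fun t => h t (z t) (z (ζ j))) (Ico (T j) (T (j + 1))) := by
    intro t₀ ht₀
    have e1 : Tendsto (fun t => h t (z t₀) (z (ζ j))) (𝓝[Ico (T j) (T (j + 1))] t₀)
        (𝓝 (h t₀ (z t₀) (z (ζ j)))) := h3 (z t₀) (z (ζ j)) t₀ ht₀
    have e2 : Tendsto (fun t => h t (z t) (z (ζ j)) - h t (z t₀) (z (ζ j)))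
        (𝓝[Ico (T j) (T (j + 1))] t₀) (𝓝 0) := by
      refine squeeze_zero_norm (a := fun t => ℓ * ‖z t - z t₀‖) (fun t => ?_) ?_
      · simpa using hB.lipschitz t (z t) (z (ζ j)) (z t₀) (z (ζ j))
      · have : Continuous fun t => ℓ * ‖z t - z t₀‖ := by fun_prop
        have h4 := this.tendsto t₀
        simp only [sub_self, norm_zero, mul_zero] at h4
        exact h4.mono_left nhdsWithin_le_nhds
    have := e1.add e2
    simpa [ContinuousWithinAt] using this
  have := ((h1.clm_apply hz.continuousOn).add
    (h2.clm_apply (continuousOn_const (c := z (ζ j))))).add hh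
  refine this.congr fun t ht => ?_
  rw [field, hA.arg_eq j t ht]
  rfl

/-- A bounded solution of an equation with piecewise continuous data is classical. -/
theorem IsSolution.isClassicalSolution [CompleteSpace V] (hA : PiecewiseArgument T ζ γ θ)
    (hB : GrowthLipschitz M M₀ h r μ ℓ) (hc : PiecewiseContinuousData T M M₀ h) {z : ℝ → V}
    (hz : IsSolution γ M M₀ h z) (hb : IsBoundedOnLine z) :
    IsClassicalSolution T γ M M₀ h z := by
  obtain ⟨C, hC⟩ := hb
  have hi := hB.locallyIntegrable_field hA hz.1 hC
  have hcont := continuousOn_field hA hB hc hz.1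
  have e : z = fun t => z 0 + ∫ s in (0 : ℝ)..t, field γ M M₀ h z s := funext fun t => by
    rw [← (hz.2 0 t).2]; abel
  have hm : ∀ l : Filter ℝ, StronglyMeasurableAtFilter (field γ M M₀ h z) l volume := fun l =>
    ⟨univ, univ_mem, hi.aestronglyMeasurable.restrict⟩
  refine ⟨hz.1, fun j t ht => ?_, fun j => ?_⟩
  · have hct : ContinuousAt (field γ M M₀ h z) t :=
      ((hcont j).mono Ioo_subset_Ico_self).continuousAt (isOpen_Ioo.mem_nhds ht)
    have := (intervalIntegral.integral_hasDerivAt_right (hi.intervalIntegrable' 0 t) (hm _)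
      hct).const_add (z 0)
    rwa [← e] at this
  -- The field may jump at `T j` from the left, so only the one-sided fundamental theorem is
  -- available.
  · have hct : ContinuousWithinAt (field γ M M₀ h z) (Ioi (T j)) (T j) :=
      ((hcont j) (T j) ⟨le_rfl, hA.grid_lt j⟩).mono_of_mem_nhdsWithin
        (mem_of_superset (Ioo_mem_nhdsGT (hA.grid_lt j)) Ioo_subset_Ico_self)
    have := (intervalIntegral.integral_hasDerivWithinAt_right (s := Ici (T j)) (t := Ioi (T j))
      (hi.intervalIntegrable' 0 (T j)) (hm _) hct).const_add (z 0)
    rwa [← e] at this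

theorem IsSolution.sub_linear {f : ℝ → V} {w u : ℝ → V}
    (hw : IsSolution γ M M₀ (fun t _ _ => f t) w)
    (hu : IsSolution γ M M₀ (fun t _ _ => f t) u) :
    IsSolution γ M M₀ (fun _ _ _ => 0) (fun t => w t - u t) := by
  have e : field γ M M₀ (fun _ _ _ => 0) (fun t => w t - u t) = fun t =>
      field γ M M₀ (fun t _ _ => f t) w t - field γ M M₀ (fun t _ _ => f t) u t := by
    funext t
    simp only [field, map_sub]
    abel
  refine ⟨hw.1.sub hu.1, fun a b => ?_⟩
  rw [e]
  refine ⟨(hw.2 a b).1.sub (hu.2 a b).1, ?_⟩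
  rw [intervalIntegral.integral_sub (hw.2 a b).1 (hu.2 a b).1, ← (hw.2 a b).2, ← (hu.2 a b).2]
  exact sub_sub_sub_comm _ _ _ _

theorem integral_green_eq (t : ℝ) {f : ℝ → V}
    (hi : Integrable (fun s => green T ζ M M₀ P t s (f s))) :
    IntegrableOn (fun s => green₁ T ζ M M₀ P t s (f s)) (Iic t) ∧
    IntegrableOn (fun s => green₂ T ζ M M₀ P t s (f s)) (Ioi t) ∧
    ∫ s, green T ζ M M₀ P t s (f s) = (∫ s in Iic t, green₁ T ζ M M₀ P t s (f s)) -
      ∫ s in Ioi t, green₂ T ζ M M₀ P t s (f s) := by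
  have e1 : EqOn (fun s => green T ζ M M₀ P t s (f s))
      (fun s => green₁ T ζ M M₀ P t s (f s)) (Iic t) := fun s hs => by
    simp only [green₁, if_pos (mem_Iic.1 hs)]
  have e2 : EqOn (fun s => -(green T ζ M M₀ P t s (f s)))
      (fun s => green₂ T ζ M M₀ P t s (f s)) (Ioi t) := fun s hs => by
    simp only [green₂, if_pos (mem_Ioi.1 hs)]
    rfl
  refine ⟨hi.integrableOn.congr_fun e1 measurableSet_Iic,
    hi.neg.integrableOn.congr_fun e2 measurableSet_Ioi, ?_⟩
  rw [← setIntegral_congr_fun measurableSet_Iic e1, ← setIntegral_congr_fun measurableSet_Ioi e2,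
    integral_neg, sub_neg_eq_add, intervalIntegral.integral_Iic_add_Ioi hi.integrableOn
    hi.integrableOn]

variable [CompleteSpace V]

/-- Every bounded solution is reproduced by the Green operator. -/
theorem IsSolution.eq_integral_green (hA : PiecewiseArgument T ζ γ θ)
    (hB : GrowthLipschitz M M₀ h r μ ℓ) (hC : SmallnessCondition T ζ M M₀ νp νm)
    (hD : ExpDichotomy T ζ M M₀ P K α) {w : ℝ → V} (hw : IsSolution γ M M₀ h w)
    (hb : IsBoundedOnLine w) (t : ℝ) :
    w t = ∫ s, green T ζ M M₀ P t s (h s (w s) (w (γ s))) := by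
  obtain ⟨C, hwC⟩ := hb
  have hf := hB.locallyIntegrable_comp hA hw.1 hwC
  have hfC := hB.norm_comp_le (γ := γ) hwC
  have hu := isSolution_green hA hB.locInt_M hB.locInt_M₀ hC hD hf hfC
  have hbd := fun t => (integrable_green_apply hA hB.locInt_M hC hD hf hfC t).2
  have hw' : IsSolution γ M M₀ (fun t _ _ => h t (w t) (w (γ t))) w := hw
  exact sub_eq_zero.1 (eq_zero_of_bounded hA hB.locInt_M hB.locInt_M₀ hC hD (hw'.sub_linear hu)
    ⟨_, fun t => (norm_sub_le _ _).trans (add_le_add (hwC t) (hbd t))⟩ t)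

/-- Existence of a bounded solution that is fixed by the Green operator, by contraction. -/
theorem exists_fixedPoint_green (hA : PiecewiseArgument T ζ γ θ)
    (hB : GrowthLipschitz M M₀ h r μ ℓ) (hC : SmallnessCondition T ζ M M₀ νp νm)
    (hD : ExpDichotomy T ζ M M₀ P K α) (hℓ : 8 * K * ℓ * rhoStar T ζ M α θ * α⁻¹ ≤ 1) :
    ∃ z : BoundedContinuousFunction ℝ V,
      (∀ t, z t = ∫ s, green T ζ M M₀ P t s (h s (z s) (z (γ s)))) ∧
      ∀ w : BoundedContinuousFunction ℝ V,
        (∀ t, w t = ∫ s, green T ζ M M₀ P t s (h s (w s) (w (γ s)))) → w = z := by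
  have hM := hB.locInt_M
  have hf := fun z : BoundedContinuousFunction ℝ V =>
    hB.locallyIntegrable_comp hA z.continuous z.norm_coe_le_norm
  have hfC := fun z : BoundedContinuousFunction ℝ V =>
    hB.norm_comp_le (γ := γ) z.norm_coe_le_norm
  let S : BoundedContinuousFunction ℝ V → BoundedContinuousFunction ℝ V := fun z =>
    BoundedContinuousFunction.ofNormedAddCommGroup
      (fun t => ∫ s, green T ζ M M₀ P t s (h s (z s) (z (γ s))))
      (isSolution_green hA hM hB.locInt_M₀ hC hD (hf z) (hfC z)).1 _
      fun t => (integrable_green_apply hA hM hC hD (hf z) (hfC z) t).2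
  have hS : ContractingWith (1 / 2) S := by
    refine ⟨by rw [← NNReal.coe_lt_coe]; norm_num, LipschitzWith.of_dist_le_mul fun y y' => ?_⟩
    rw [BoundedContinuousFunction.dist_le (by positivity)]
    intro t
    have hdiff : ∀ s, ‖h s (y s) (y (γ s)) - h s (y' s) (y' (γ s))‖ ≤ 2 * ℓ * dist y y' := by
      intro s
      refine (hB.lipschitz _ _ _ _ _).trans ?_
      rw [← dist_eq_norm, ← dist_eq_norm]
      have h1 := BoundedContinuousFunction.dist_coe_le_dist (f := y) (g := y') s
      have h2 := BoundedContinuousFunction.dist_coe_le_dist (f := y) (g := y') (γ s)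
      have := mul_le_mul_of_nonneg_left (add_le_add h1 h2) hB.ell_pos.le
      linarith
    have hb := (integrable_green_apply hA hM hC hD ((hf y).sub (hf y')) hdiff t).2
    have e : dist (S y t) (S y' t) = ‖∫ s, green T ζ M M₀ P t s
        (h s (y s) (y (γ s)) - h s (y' s) (y' (γ s)))‖ := by
      rw [dist_eq_norm]
      simp only [S, BoundedContinuousFunction.coe_ofNormedAddCommGroup, map_sub]
      rw [integral_sub (integrable_green_apply hA hM hC hD (hf y) (hfC y) t).1
        (integrable_green_apply hA hM hC hD (hf y') (hfC y') t).1]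
    rw [e]
    refine hb.trans ?_
    -- The superposition has Lipschitz constant `2ℓ`, one `ℓ` for each space argument, so the total
    -- constant is half of `8Kℓρ*α⁻¹`.
    have h3 : 2 * K * rhoStar T ζ M α θ * α⁻¹ * (2 * ℓ * dist y y') =
        (8 * K * ℓ * rhoStar T ζ M α θ * α⁻¹) * (1 / 2 * dist y y') := by ring
    rw [h3]
    refine (mul_le_mul_of_nonneg_right hℓ (by positivity)).trans (le_of_eq ?_)
    norm_num
  refine ⟨hS.fixedPoint, fun t => ?_, fun w hw => ?_⟩
  · exact (DFunLike.congr_fun hS.fixedPoint_isFixedPt t).symm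
  · refine hS.fixedPoint_unique (BoundedContinuousFunction.ext fun t => ?_)
    exact (hw t).symm

end Nonlinear

end Depcag

end

/-! ### The main theorem -/

theorem theorem1 {V : Type*} [NormedAddCommGroup V] [NormedSpace ℝ V] [FiniteDimensional ℝ V]
    (T ζ : ℤ → ℝ) (γ : ℝ → ℝ) (θ : ℝ)
    (M M₀ : ℝ → V →L[ℝ] V) (h : ℝ → V → V → V) (r μ ℓ νp νm : ℝ)
    (P : V →L[ℝ] V) (K α : ℝ)
    (hA : Depcag.PiecewiseArgument T ζ γ θ)
    (hB : Depcag.GrowthLipschitz M M₀ h r μ ℓ)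
    (hC : Depcag.SmallnessCondition T ζ M M₀ νp νm)
    (hD : Depcag.ExpDichotomy T ζ M M₀ P K α)
    (hℓ : 8 * K * ℓ * Depcag.rhoStar T ζ M α θ * α⁻¹ ≤ 1)
    (hr : 4 * K * r * Depcag.rhoStar T ζ M α θ * α⁻¹ ≤ 1) :
    ∃ z : ℝ → V,
      -- `z` is a bounded solution, and it is the only one
      Depcag.IsSolution γ M M₀ h z ∧ Depcag.IsBoundedOnLine z ∧
      (∀ w : ℝ → V, Depcag.IsSolution γ M M₀ h w → Depcag.IsBoundedOnLine w → w = z) ∧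
      -- also within the class of classical solutions, to which `z` belongs for regular data
      (∀ w : ℝ → V, Depcag.IsClassicalSolution T γ M M₀ h w → Depcag.IsBoundedOnLine w → w = z) ∧
      (Depcag.PiecewiseContinuousData T M M₀ h → Depcag.IsClassicalSolution T γ M M₀ h z) ∧
      -- representation by the Green operator, with absolutely convergent integrals
      (∀ t : ℝ,
        IntegrableOn (fun s => Depcag.green₁ T ζ M M₀ P t s (h s (z s) (z (γ s)))) (Iic t) ∧
        IntegrableOn (fun s => Depcag.green₂ T ζ M M₀ P t s (h s (z s) (z (γ s)))) (Ioi t) ∧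
        z t = (∫ s in Iic t, Depcag.green₁ T ζ M M₀ P t s (h s (z s) (z (γ s)))) -
          ∫ s in Ioi t, Depcag.green₂ T ζ M M₀ P t s (h s (z s) (z (γ s)))) ∧
      -- the explicit bound, whenever its denominator does not vanish
      (4 * r * K * Depcag.rhoStar T ζ M α θ < α → ∀ t : ℝ,
        ‖z t‖ ≤ 2 * K * μ * Depcag.rhoStar T ζ M α θ *
          (α - 4 * r * K * Depcag.rhoStar T ζ M α θ)⁻¹) := by

  have hM := hB.locInt_M
  obtain ⟨z, hz, hzu⟩ := Depcag.exists_fixedPoint_green hA hB hC hD hℓ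
  have hf := hB.locallyIntegrable_comp hA z.continuous z.norm_coe_le_norm
  have hfC := hB.norm_comp_le (γ := γ) z.norm_coe_le_norm
  have hsol : Depcag.IsSolution γ M M₀ h z := by
    have := Depcag.isSolution_green hA hM hB.locInt_M₀ hC hD hf hfC
    rwa [← show (z : ℝ → V) = _ from funext hz] at this
  have hbdd : Depcag.IsBoundedOnLine z := ⟨‖z‖, z.norm_coe_le_norm⟩
  have huniq : ∀ w : ℝ → V, Depcag.IsSolution γ M M₀ h w → Depcag.IsBoundedOnLine w → w = z := by
    intro w hw hb
    obtain ⟨C, hwC⟩ := hb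
    have := hzu (BoundedContinuousFunction.ofNormedAddCommGroup w hw.1 C hwC)
      (hw.eq_integral_green hA hB hC hD ⟨C, hwC⟩)
    rw [← this]
    rfl
  refine ⟨z, hsol, hbdd, huniq, fun w hw hb => huniq w (hw.isSolution hA hB hb) hb,
    fun hc => hsol.isClassicalSolution hA hB hc hbdd, fun t => ?_, fun hlt t => ?_⟩
  · have hi := (Depcag.integrable_green_apply hA hM hC hD hf hfC t).1
    rw [hz t]
    exact Depcag.integral_green_eq t hi
  · have hα := hD.alpha_pos
    have hK : 0 ≤ K := zero_le_one.trans hD.one_le_K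
    have hρ : 0 ≤ Depcag.rhoStar T ζ M α θ :=
      mul_nonneg (zero_le_one.trans (Depcag.one_le_rho hC hA)) (Real.exp_pos _).le
    -- The growth bound is inserted into the fixed-point equation. Multiplying by `α` and absorbing
    -- the `‖z‖` term on the left gives `σ`.
    have hn : ‖z‖ ≤ 2 * K * Depcag.rhoStar T ζ M α θ * α⁻¹ * (2 * r * ‖z‖ + μ) := by
      have hr0 := hB.r_pos
      have hμ0 := hB.mu_pos
      refine (BoundedContinuousFunction.norm_le (by positivity)).2 fun t => ?_
      rw [hz t]
      exact (Depcag.integrable_green_apply hA hM hC hD hf hfC t).2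
    refine (z.norm_coe_le_norm t).trans ?_
    rw [← div_eq_mul_inv, le_div_iff₀ (by linarith)]
    have := mul_le_mul_of_nonneg_left hn hα.le
    have e : α * (2 * K * Depcag.rhoStar T ζ M α θ * α⁻¹ * (2 * r * ‖z‖ + μ)) =
        2 * K * Depcag.rhoStar T ζ M α θ * (2 * r * ‖z‖ + μ) := by
      field_simp
    rw [e] at this
    linarith
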